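/- Let $\Bbbk$ be an algebraically closed field and let $\mathcal E$ be a $\Bbbk$-linear additive category such that: (a) $\mathcal E$ is Krull–Schmidt, i.e. every object is a finite direct sum of objects with local endomorphism rings; (b) $\dim_\Bbbk \mathcal E(X,Y)<\infty$ for all $X,Y$; (c) the category $\operatorname{mod}\mathcal E$ of finitely presented contravariant functors $\mathcal E\to\mathrm{Ab}$ (cokernels of maps $\mathcal E(-,X)\to\mathcal E(-,Y)$) is abelian (equivalently, $\mathcal E$ has weak kernels); (d) $\operatorname{mod}\mathcal E$ has finite global dimension. Let $\mathcal E$ carry a Frobenius exact structure (a Quillen exact structure with enough projective and enough injective objects, in which projective and injective objects coincide), and let $\mathcal P$ be its class of projective-injective objects. Let $\mathcal E/\mathcal P$ be the additive quotient of $\mathcal E$ by the ideal of morphisms factoring through objects of $\mathcal P$, with suspension $\Sigma$ the cosyzygy functor. Suppose this stable category is $2$-Calabi–Yau, i.e. there are $\Bbbk$-linear isomorphisms $\operatorname{Hom}_{\mathcal E/\mathcal P}(X,Y)\cong \operatorname{Hom}_\Bbbk(\operatorname{Hom}_{\mathcal E/\mathcal P}(Y,\Sigma^2X),\Bbbk)$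 natural in $X$ and $Y$. Let $\mathcal T\subseteq\mathcal E$ be a cluster-tilting subcategory, i.e. a full subcategory such that $\operatorname{Ext}^1(T,T')=0$ for all $T,T'\in\mathcal T$; every object $X$ with $\operatorname{Ext}^1(T,X)=0$ for all $T\in\mathcal T$ lies in $\mathcal T$; and $\mathcal T$ is functorially finite in $\mathcal E$ (every object of $\mathcal E$ has a right and a left $\mathcal T$-approximation). Here $\operatorname{Ext}^1$ is taken in the exact category $\mathcal E$. The quiver of a category $\mathcal A$ has as vertices the isomorphism classes $[X]$ of indecomposable objects, and an arrow $[X]\to[Y]$ precisely if $\operatorname{rad}_{\mathcal A}(X,Y)/\operatorname{rad}^2_{\mathcal A}(X,Y)\neq 0$, where $\operatorname{rad}_{\mathcal A}(X,Y)$ consists of the morphisms $f\colon X\to Y$ such that $1_X-gf$ is invertible for all $g\colon Y\to X$, and $\operatorname{rad}^2_{\mathcal A}(X,Y)$ of the composites of two radical morphisms. Then the quiver of $\mathcal T/\mathcal P$, the quotient of $\mathcal T$ by the morphisms factoring through objects of $\mathcal P$, has no loops and no $2$-cycles: there is no vertex $x$ with an arrow $x\to x$, and there are no vertices $x,y$ with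 arrows $x\to y$ and $y\to x$. -/

import Mathlib

open CategoryTheory CategoryTheory.Limits

universe w v u

namespace FrobeniusCT

/-! ### Krull--Schmidt categories, the radical and the quiver of a category -/

/-- Every object is a finite direct sum of objects with local endomorphism rings
(the empty direct sum being allowed). -/
def IsKrullSchmidt (C : Type u) [Category.{v} C] [Preadditive C] [HasFiniteBiproducts C] : Prop :=
  ∀ X : C, ∃ (n : ℕ) (Y : Fin n → C),
    (∀ i, IsLocalRing (End (Y i))) ∧ Nonempty (X ≅ ⨁ Y)

section Quiver

variable {C : Type u} [Category.{v} C] [Preadditive C]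

/-- `X` is nonzero and in every decomposition `X ≅ Y ⊕ Z` one of `Y`, `Z` is zero. (Phrased with
biproduct bicones, so that the existence of all biproducts need not be known beforehand.) -/
def IsIndecomposable (X : C) : Prop :=
  ¬ IsZero X ∧ ∀ (Y Z : C) (b : BinaryBicone Y Z),
    Nonempty b.IsBilimit → Nonempty (X ≅ b.pt) → IsZero Y ∨ IsZero Z

/-- `f : X ⟶ Y` lies in the radical: `1 - g ∘ f` is invertible for every `g : Y ⟶ X`. -/
def InRad {X Y : C} (f : X ⟶ Y) : Prop :=
  ∀ g : Y ⟶ X, IsIso (𝟙 X - f ≫ g)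

/-- `f` lies in the square of the radical: it is a composite of two radical morphisms. -/
def InRadSq {X Y : C} (f : X ⟶ Y) : Prop :=
  ∃ (Z : C) (g : X ⟶ Z) (h : Z ⟶ Y), InRad g ∧ InRad h ∧ f = g ≫ h

/-- `rad(X, Y) / rad²(X, Y) ≠ 0`. -/
def HasIrreducible (X Y : C) : Prop :=
  ∃ f : X ⟶ Y, InRad f ∧ ¬ InRadSq f

variable (C)

/-- Vertices of the quiver of `C`: isomorphism classes of indecomposable objects. -/
def QuiverVertex : Type u :=
  {x : _root_.Quotient (isIsomorphicSetoid C) //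
    ∃ X : C, IsIndecomposable X ∧ _root_.Quotient.mk (isIsomorphicSetoid C) X = x}

/-- The quiver of `C`, without double arrows: there is an arrow `[X] ⟶ [Y]` precisely if
`rad(X, Y) / rad²(X, Y) ≠ 0`. -/
instance quiverOfCategory : Quiver.{0} (QuiverVertex C) where
  Hom x y := PLift (∃ X Y : C, _root_.Quotient.mk (isIsomorphicSetoid C) X = x.1 ∧
    _root_.Quotient.mk (isIsomorphicSetoid C) Y = y.1 ∧ HasIrreducible X Y)

end Quiver

/-- A quiver has no loops. -/
def NoLoops (Q : Type u) [Quiver.{0} Q] : Prop :=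
  ∀ x : Q, IsEmpty (x ⟶ x)

/-- A quiver has no 2-cycles. -/
def NoTwoCycles (Q : Type u) [Quiver.{0} Q] : Prop :=
  ∀ x y : Q, IsEmpty ((x ⟶ y) × (y ⟶ x))

/-! ### Finitely presented functors -/

/-- A contravariant functor to abelian groups is finitely presented if it is the cokernel of
`C(-, f) : C(-, X) ⟶ C(-, Y)` for some `f : X ⟶ Y`. -/
def isFinPres (C : Type u) [Category.{v} C] [Preadditive C] :
    ObjectProperty (Cᵒᵖ ⥤ AddCommGrpCat.{v}) :=
  fun F => ∃ (X Y : C) (f : X ⟶ Y), Nonempty (F ≅ cokernel (preadditiveYoneda.map f))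

/-- The category `mod C` of finitely presented contravariant functors. -/
abbrev ModCat (C : Type u) [Category.{v} C] [Preadditive C] :=
  (isFinPres C).FullSubcategory

/-- A preadditive category is abelian. -/
structure IsAbelian (A : Type u) [Category.{v} A] [Preadditive A] : Prop where
  finite_products : HasFiniteProducts A
  kernels : HasKernels A
  cokernels : HasCokernels A
  normal_mono : IsNormalMonoCategory A
  normal_epi : IsNormalEpiCategory A

/-- The resulting abelian category structure in the sense of Mathlib. -/
@[reducible]
def IsAbelian.toAbelian {A : Type u} [Category.{v} A] [Preadditive A] (h : IsAbelian A) :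
    Abelian A :=
  have := h.finite_products
  have := h.kernels
  have := h.cokernels
  have := h.normal_mono
  have := h.normal_epi
  { toPreadditive := inferInstance
    normalMonoOfMono := h.normal_mono.normalMonoOfMono
    normalEpiOfEpi := h.normal_epi.normalEpiOfEpi }

/-- Finite global dimension: a uniform bound on the projective dimensions of all objects, i.e. for
some `n`, all groups `Ext^i(F, G)` with `i > n` vanish. -/
def IsAbelian.FiniteGlobalDimension {A : Type u} [Category.{v} A] [Preadditive A]
    (h : IsAbelian A) : Prop :=
  letI := h.toAbelian
  ∃ n : ℕ, ∀ F : A, HasProjectiveDimensionLE F n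

/-! ### The additive quotient by a class of objects -/

section AddQuotient

variable {C : Type u} [Category.{v} C] [Preadditive C]

/-- The ideal of morphisms generated by those factoring through an object of `P`. (If `P` is closed
under finite direct sums, every element factors through a single object of `P`.) -/
def factorIdeal (P : ObjectProperty C) (X Y : C) : AddSubgroup (X ⟶ Y) :=
  AddSubgroup.closure {f | ∃ (Z : C) (_ : P Z) (a : X ⟶ Z) (b : Z ⟶ Y), f = a ≫ b}

theorem factorIdeal_comp_right (P : ObjectProperty C) {X Y Z : C} {f : X ⟶ Y}
    (hf : f ∈ factorIdeal P X Y) (g : Y ⟶ Z) : f ≫ g ∈ factorIdeal P X Z := by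
  have : factorIdeal P X Y ≤ (factorIdeal P X Z).comap (Preadditive.rightComp X g) := by
    refine (AddSubgroup.closure_le _).2 ?_
    rintro _ ⟨W, hW, a, b, rfl⟩
    exact AddSubgroup.subset_closure ⟨W, hW, a, b ≫ g, Category.assoc _ _ _⟩
  exact this hf

theorem factorIdeal_comp_left (P : ObjectProperty C) {X Y Z : C} (f : X ⟶ Y) {g : Y ⟶ Z}
    (hg : g ∈ factorIdeal P Y Z) : f ≫ g ∈ factorIdeal P X Z := by
  have : factorIdeal P Y Z ≤ (factorIdeal P X Z).comap (Preadditive.leftComp Z f) := by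
    refine (AddSubgroup.closure_le _).2 ?_
    rintro _ ⟨W, hW, a, b, rfl⟩
    exact AddSubgroup.subset_closure ⟨W, hW, f ≫ a, b, (Category.assoc _ _ _).symm⟩
  exact this hg

theorem factorIdeal_smul {k : Type w} [Field k] [Linear k C] (P : ObjectProperty C) {X Y : C}
    (c : k) {f : X ⟶ Y} (hf : f ∈ factorIdeal P X Y) : c • f ∈ factorIdeal P X Y := by
  have := factorIdeal_comp_right P hf (c • 𝟙 Y)
  simpa using this

/-- Two morphisms are identified if their difference lies in the ideal. -/
def idealRel (P : ObjectProperty C) : HomRel C :=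
  fun X Y f g => f - g ∈ factorIdeal P X Y

instance (P : ObjectProperty C) : Congruence (idealRel P) where
  equivalence :=
    { refl := fun f => by simp [idealRel]
      symm := fun {f g} h => by
        have := (factorIdeal P _ _).neg_mem h
        simpa [idealRel] using this
      trans := fun {f g h} h₁ h₂ => by
        have := (factorIdeal P _ _).add_mem h₁ h₂
        simpa [idealRel] using this }
  comp_left {_ _ _} f {g g'} h := by
    have := factorIdeal_comp_left P f (g := g - g') h
    simpa [idealRel] using this
  comp_right {_ _ _} {f f'} g h := by
    have := factorIdeal_comp_right P (f := f - f') h g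
    simpa [idealRel] using this

theorem idealRel_add (P : ObjectProperty C) ⦃X Y : C⦄ (f₁ f₂ g₁ g₂ : X ⟶ Y)
    (hf : idealRel P f₁ f₂) (hg : idealRel P g₁ g₂) : idealRel P (f₁ + g₁) (f₂ + g₂) := by
  have := (factorIdeal P _ _).add_mem hf hg
  simpa only [idealRel, add_sub_add_comm] using this

theorem idealRel_smul {k : Type w} [Field k] [Linear k C] (P : ObjectProperty C) (c : k)
    ⦃X Y : C⦄ (f g : X ⟶ Y) (h : idealRel P f g) : idealRel P (c • f) (c • g) := by
  have := factorIdeal_smul P c h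
  simpa only [idealRel, smul_sub] using this

/-- The additive quotient `C / P`: the objects of `C`, with morphisms taken modulo the ideal of
those factoring through `P`. -/
abbrev AddQuotient (P : ObjectProperty C) := CategoryTheory.Quotient (idealRel P)

instance addQuotientPreadditive (P : ObjectProperty C) : Preadditive (AddQuotient P) :=
  CategoryTheory.Quotient.preadditive (idealRel P) (idealRel_add P)

instance addQuotientFunctorAdditive (P : ObjectProperty C) :
    (CategoryTheory.Quotient.functor (idealRel P)).Additive :=
  CategoryTheory.Quotient.functor_additive (idealRel P) (idealRel_add P)

instance addQuotientLinear {k : Type w} [Field k] [Linear k C] (P : ObjectProperty C) :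
    Linear k (AddQuotient P) :=
  CategoryTheory.Quotient.linear k (idealRel P) (idealRel_smul P)

end AddQuotient

/-- `T` is functorially finite: every object has a right and a left `T`-approximation. -/
def FunctoriallyFinite {C : Type u} [Category.{v} C] (T : ObjectProperty C) : Prop :=
  (∀ X : C, ∃ (M : C) (f : M ⟶ X), T M ∧ ∀ (N : C), T N → ∀ g : N ⟶ X, ∃ h : N ⟶ M, h ≫ f = g) ∧
  (∀ X : C, ∃ (M : C) (f : X ⟶ M), T M ∧ ∀ (N : C), T N → ∀ g : X ⟶ N, ∃ h : M ⟶ N, f ≫ h = g)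

/-! ### Exact categories -/

/-- `i : A ⟶ B` is the first map of some member `A ⟶ B ⟶ Z` of the class `𝒮`. -/
def IsInflation {C : Type u} [Category.{v} C] [Preadditive C] (𝒮 : ObjectProperty (ShortComplex C))
    {A B : C} (i : A ⟶ B) : Prop :=
  ∃ (Z : C) (p : B ⟶ Z) (h : i ≫ p = 0), 𝒮 (ShortComplex.mk i p h)

/-- `p : A ⟶ B` is the second map of some member `Z ⟶ A ⟶ B` of the class `𝒮`. -/
def IsDeflation {C : Type u} [Category.{v} C] [Preadditive C] (𝒮 : ObjectProperty (ShortComplex C))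
    {A B : C} (p : A ⟶ B) : Prop :=
  ∃ (Z : C) (i : Z ⟶ A) (h : i ≫ p = 0), 𝒮 (ShortComplex.mk i p h)

/-- An exact structure in the sense of Quillen: a class of kernel-cokernel pairs
`A ⟶ B ⟶ C` (the conflations; the first maps are the inflations, the second maps the deflations),
closed under isomorphism, such that identities are inflations and deflations, inflations and
deflations are closed under composition, pushouts of inflations along arbitrary morphisms exist and
are inflations, and dually for pullbacks of deflations. -/
structure ExactStructure (C : Type u) [Category.{v} C] [Preadditive C] where
  conflation : ObjectProperty (ShortComplex C)
  of_iso : ∀ {S S' : ShortComplex C}, (S ≅ S') → conflation S → conflation S'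
  isKernel : ∀ S : ShortComplex C, conflation S → Nonempty (IsLimit (KernelFork.ofι S.f S.zero))
  isCokernel : ∀ S : ShortComplex C, conflation S →
    Nonempty (IsColimit (CokernelCofork.ofπ S.g S.zero))
  inflation_id : ∀ A : C, IsInflation conflation (𝟙 A)
  deflation_id : ∀ A : C, IsDeflation conflation (𝟙 A)
  inflation_comp : ∀ {A B D : C} (i : A ⟶ B) (j : B ⟶ D),
    IsInflation conflation i → IsInflation conflation j → IsInflation conflation (i ≫ j)
  deflation_comp : ∀ {A B D : C} (p : A ⟶ B) (q : B ⟶ D),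
    IsDeflation conflation p → IsDeflation conflation q → IsDeflation conflation (p ≫ q)
  pushout : ∀ {A B A' : C} (i : A ⟶ B) (f : A ⟶ A'), IsInflation conflation i →
    ∃ (B' : C) (f' : B ⟶ B') (i' : A' ⟶ B'), IsPushout i f f' i' ∧ IsInflation conflation i'
  pullback : ∀ {B D D' : C} (p : B ⟶ D) (f : D' ⟶ D), IsDeflation conflation p →
    ∃ (B' : C) (f' : B' ⟶ B) (p' : B' ⟶ D'), IsPullback f' p' p f ∧ IsDeflation conflation p'

namespace ExactStructure

variable {C : Type u} [Category.{v} C] [Preadditive C] (S : ExactStructure C)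

/-- `i` is an inflation. -/
abbrev inflation {A B : C} (i : A ⟶ B) : Prop := IsInflation S.conflation i

/-- `p` is a deflation. -/
abbrev deflation {A B : C} (p : A ⟶ B) : Prop := IsDeflation S.conflation p

/-- The projective objects: morphisms out of them lift along deflations. -/
def proj : ObjectProperty C := fun Q =>
  ∀ ⦃A B : C⦄ (p : A ⟶ B), S.deflation p → ∀ f : Q ⟶ B, ∃ g : Q ⟶ A, g ≫ p = f

/-- The injective objects: morphisms into them extend along inflations. -/
def inj : ObjectProperty C := fun Q =>
  ∀ ⦃A B : C⦄ (i : A ⟶ B), S.inflation i → ∀ f : A ⟶ Q, ∃ g : B ⟶ Q, i ≫ g = f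

/-- Frobenius exact: enough projectives, enough injectives, and the two classes coincide. -/
structure IsFrobenius : Prop where
  enough_proj : ∀ X : C, ∃ (Q : C) (p : Q ⟶ X), S.proj Q ∧ S.deflation p
  enough_inj : ∀ X : C, ∃ (Q : C) (i : X ⟶ Q), S.inj Q ∧ S.inflation i
  proj_iff_inj : ∀ X : C, S.proj X ↔ S.inj X

/-- An extension of `X` by `Y`: a conflation `Y ⟶ Z ⟶ X`. -/
structure Extension (X Y : C) where
  mid : C
  i : Y ⟶ mid
  p : mid ⟶ X
  zero : i ≫ p = 0
  conflation : S.conflation (ShortComplex.mk i p zero)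

/-- Equivalence of extensions: an isomorphism of the middle terms compatible with the identities
of the outer terms. -/
def Extension.Equiv {S : ExactStructure C} {X Y : C} (e e' : S.Extension X Y) : Prop :=
  ∃ φ : e.mid ≅ e'.mid, e.i ≫ φ.hom = e'.i ∧ φ.hom ≫ e'.p = e.p

/-- (The underlying set of) `Ext¹(X, Y)`: extensions of `X` by `Y` up to equivalence. -/
def Ext1 (X Y : C) : Type (max u v) := Quot (Extension.Equiv (S := S) (X := X) (Y := Y))

/-- `Ext¹(X, Y) = 0`: all extensions of `X` by `Y` are equivalent (hence to the split one). -/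
def Ext1Vanishes (X Y : C) : Prop := Subsingleton (S.Ext1 X Y)

/-- Cluster-tilting subcategories, as full subcategories given by a class of objects `T`. (Closure
under isomorphism, finite direct sums and direct summands follows from the conditions.) -/
structure IsClusterTilting (T : ObjectProperty C) : Prop where
  rigid : ∀ X Y : C, T X → T Y → S.Ext1Vanishes X Y
  maximal : ∀ X : C, (∀ Y : C, T Y → S.Ext1Vanishes Y X) → T X
  functoriallyFinite : FunctoriallyFinite T

/-! ### The stable category and the cosyzygy functor -/

/-- The (underlying category of the) stable category: the additive quotient by the
projective(-injective) objects. -/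
abbrev Stable := AddQuotient S.proj

/-- The quotient functor to the stable category. -/
abbrev toStable : C ⥤ S.Stable := CategoryTheory.Quotient.functor (idealRel S.proj)

theorem toStable_map_eq_iff {X Y : C} (f g : X ⟶ Y) :
    S.toStable.map f = S.toStable.map g ↔ f - g ∈ factorIdeal S.proj X Y :=
  CategoryTheory.Quotient.functor_map_eq_iff (idealRel S.proj) f g

/-- A conflation `X ⟶ I ⟶ Z` with `I` injective. -/
structure InjHull (X : C) where
  I : C
  Z : C
  i : X ⟶ I
  p : I ⟶ Z
  zero : i ≫ p = 0
  conflation : S.conflation (ShortComplex.mk i p zero)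
  inj : S.inj I

variable {S}

theorem IsFrobenius.nonempty_injHull (hS : S.IsFrobenius) (X : C) : Nonempty (S.InjHull X) := by
  obtain ⟨I, i, hI, hi⟩ := hS.enough_inj X
  obtain ⟨Z, p, h, hc⟩ := hi
  exact ⟨⟨I, Z, i, p, h, hc, hI⟩⟩

/-- A chosen conflation `X ⟶ I ⟶ ΣX` with `I` injective. -/
noncomputable def IsFrobenius.hull (hS : S.IsFrobenius) (X : C) : S.InjHull X :=
  (hS.nonempty_injHull X).some

/-- `g` is the map induced on cosyzygies by `f` through some map of the middle terms. -/
def InjHull.Induces {X Y : C} (H : S.InjHull X) (K : S.InjHull Y) (f : X ⟶ Y) (g : H.Z ⟶ K.Z) :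
    Prop :=
  ∃ h : H.I ⟶ K.I, H.i ≫ h = f ≫ K.i ∧ H.p ≫ g = h ≫ K.p

theorem InjHull.exists_desc {X : C} (H : S.InjHull X) {W : C} (h : H.I ⟶ W) (w : H.i ≫ h = 0) :
    ∃ s : H.Z ⟶ W, H.p ≫ s = h := by
  obtain ⟨hc⟩ := S.isCokernel _ H.conflation
  exact ⟨hc.desc (CokernelCofork.ofπ h w), hc.fac _ WalkingParallelPair.one⟩

theorem InjHull.p_cancel {X : C} (H : S.InjHull X) {W : C} {g g' : H.Z ⟶ W}
    (w : H.p ≫ g = H.p ≫ g') : g = g' := by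
  obtain ⟨hc⟩ := S.isCokernel _ H.conflation
  exact Cofork.IsColimit.hom_ext hc w

theorem InjHull.inflation {X : C} (H : S.InjHull X) : S.inflation H.i :=
  ⟨_, _, H.zero, H.conflation⟩

theorem InjHull.exists_induces {X Y : C} (H : S.InjHull X) (K : S.InjHull Y) (f : X ⟶ Y) :
    ∃ g, H.Induces K f g := by
  obtain ⟨h, hh⟩ := K.inj H.i H.inflation (f ≫ K.i)
  obtain ⟨g, hg⟩ := H.exists_desc (h ≫ K.p) (by rw [reassoc_of% hh, K.zero, comp_zero])
  exact ⟨g, h, hh, hg⟩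

theorem InjHull.Induces.sub {X Y : C} {H : S.InjHull X} {K : S.InjHull Y} {f f' : X ⟶ Y}
    {g g' : H.Z ⟶ K.Z} (a : H.Induces K f g) (b : H.Induces K f' g') :
    H.Induces K (f - f') (g - g') := by
  obtain ⟨h, h₁, h₂⟩ := a
  obtain ⟨h', h₁', h₂'⟩ := b
  exact ⟨h - h', by simp [h₁, h₁'], by simp [h₂, h₂']⟩

theorem InjHull.Induces.comp {X Y W : C} {H : S.InjHull X} {K : S.InjHull Y} {L : S.InjHull W}
    {f : X ⟶ Y} {f' : Y ⟶ W} {g : H.Z ⟶ K.Z} {g' : K.Z ⟶ L.Z} (a : H.Induces K f g)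
    (b : K.Induces L f' g') : H.Induces L (f ≫ f') (g ≫ g') := by
  obtain ⟨h, h₁, h₂⟩ := a
  obtain ⟨h', h₁', h₂'⟩ := b
  exact ⟨h ≫ h', by simp [reassoc_of% h₁, h₁'], by simp [reassoc_of% h₂, h₂']⟩

theorem InjHull.Induces.mem_of_zero (hS : S.IsFrobenius) {X Y : C} {H : S.InjHull X}
    {K : S.InjHull Y} {g : H.Z ⟶ K.Z} (a : H.Induces K 0 g) :
    g ∈ factorIdeal S.proj H.Z K.Z := by
  obtain ⟨h, h₁, h₂⟩ := a
  obtain ⟨s, hs⟩ := H.exists_desc h (by rw [h₁, zero_comp])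
  refine AddSubgroup.subset_closure ⟨K.I, (hS.proj_iff_inj _).2 K.inj, s, K.p, ?_⟩
  apply H.p_cancel
  rw [h₂, reassoc_of% hs]

theorem InjHull.Induces.mem (hS : S.IsFrobenius) {X Y : C} {H : S.InjHull X} {K : S.InjHull Y}
    {f : X ⟶ Y} {g : H.Z ⟶ K.Z} (a : H.Induces K f g) (hf : f ∈ factorIdeal S.proj X Y) :
    g ∈ factorIdeal S.proj H.Z K.Z := by
  have key : ∃ g', H.Induces K f g' ∧ g' ∈ factorIdeal S.proj H.Z K.Z := by
    clear a
    induction hf using AddSubgroup.closure_induction with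
    | mem f hf =>
      obtain ⟨Q, hQ, c, d, rfl⟩ := hf
      obtain ⟨c', hc'⟩ := (hS.proj_iff_inj _).1 hQ H.i H.inflation c
      exact ⟨0, ⟨c' ≫ d ≫ K.i, by simp [reassoc_of% hc'], by simp [K.zero]⟩, zero_mem _⟩
    | zero => exact ⟨0, ⟨0, by simp, by simp⟩, zero_mem _⟩
    | add f f' _ _ hf hf' =>
      obtain ⟨g, ⟨h, h₁, h₂⟩, hg⟩ := hf
      obtain ⟨g', ⟨h', h₁', h₂'⟩, hg'⟩ := hf'
      exact ⟨g + g', ⟨h + h', by simp [h₁, h₁'], by simp [h₂, h₂']⟩, add_mem hg hg'⟩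
    | neg f _ hf =>
      obtain ⟨g, ⟨h, h₁, h₂⟩, hg⟩ := hf
      exact ⟨-g, ⟨-h, by simp [h₁], by simp [h₂]⟩, neg_mem hg⟩
  obtain ⟨g', a', hg'⟩ := key
  have h0 := a.sub a'
  rw [sub_self] at h0
  simpa using add_mem (h0.mem_of_zero hS) hg'

theorem InjHull.Induces.eq (hS : S.IsFrobenius) {X Y : C} {H : S.InjHull X} {K : S.InjHull Y}
    {f f' : X ⟶ Y} {g g' : H.Z ⟶ K.Z} (a : H.Induces K f g) (a' : H.Induces K f' g')
    (hf : f - f' ∈ factorIdeal S.proj X Y) : S.toStable.map g = S.toStable.map g' :=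
  (S.toStable_map_eq_iff g g').2 ((a.sub a').mem hS hf)

/-- A chosen map on cosyzygies induced by `f`. -/
noncomputable def IsFrobenius.cosyzygyMap (hS : S.IsFrobenius) {X Y : C} (f : X ⟶ Y) :
    (hS.hull X).Z ⟶ (hS.hull Y).Z :=
  ((hS.hull X).exists_induces (hS.hull Y) f).choose

theorem IsFrobenius.cosyzygyMap_induces (hS : S.IsFrobenius) {X Y : C} (f : X ⟶ Y) :
    (hS.hull X).Induces (hS.hull Y) f (hS.cosyzygyMap f) :=
  ((hS.hull X).exists_induces (hS.hull Y) f).choose_spec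

/-- The suspension `Σ` of the stable category: the cosyzygy functor, `ΣX` being the cokernel of an
inflation of `X` into an injective object. -/
noncomputable def IsFrobenius.suspension (hS : S.IsFrobenius) : S.Stable ⥤ S.Stable :=
  CategoryTheory.Quotient.lift (idealRel S.proj)
    { obj := fun X => S.toStable.obj (hS.hull X).Z
      map := fun f => S.toStable.map (hS.cosyzygyMap f)
      map_id := fun X => by
        rw [← S.toStable.map_id]
        exact (hS.cosyzygyMap_induces (𝟙 X)).eq hS (f' := 𝟙 X) ⟨𝟙 _, by simp, by simp⟩ (by simp)
      map_comp := fun f g => by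
        rw [← S.toStable.map_comp]
        exact (hS.cosyzygyMap_induces (f ≫ g)).eq hS
          ((hS.cosyzygyMap_induces f).comp (hS.cosyzygyMap_induces g)) (by simp) }
    (fun _ _ f g h => (hS.cosyzygyMap_induces f).eq hS (hS.cosyzygyMap_induces g) h)

end ExactStructure

/-- `F` satisfies Serre duality: there are `k`-linear isomorphisms
`Hom(X, Y) ≅ D Hom(Y, F X)`, natural in `X` and `Y`. -/
def SerreDuality (k : Type w) [Field k] {C : Type u} [Category.{v} C] [Preadditive C] [Linear k C]
    (F : C ⥤ C) : Prop :=
  ∃ e : ∀ X Y : C, (X ⟶ Y) ≃ₗ[k] Module.Dual k (Y ⟶ F.obj X),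
    ∀ {X X' Y Y' : C} (a : X' ⟶ X) (f : X ⟶ Y) (b : Y ⟶ Y') (h : Y' ⟶ F.obj X'),
      e X' Y' (a ≫ f ≫ b) h = e X Y f (b ≫ h ≫ F.map a)

/-- The stable category is 2-Calabi--Yau: `Σ²` is a Serre functor. (`Σ` is automatically an
autoequivalence of the stable category of a Frobenius exact category.) -/
def ExactStructure.IsTwoCalabiYau (k : Type w) [Field k] {C : Type u} [Category.{v} C]
    [Preadditive C] [Linear k C] {S : ExactStructure C} (hS : S.IsFrobenius) : Prop :=
  SerreDuality k (hS.suspension ⋙ hS.suspension)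

/-- For a full subcategory `T`, the quotient `T / P` by the ideal of morphisms factoring through
the objects of `P` that lie in `T`. -/
abbrev SubQuotient {C : Type u} [Category.{v} C] [Preadditive C] (T P : ObjectProperty C) :=
  AddQuotient (P.inverseImage T.ι)

end FrobeniusCT

/-! The argument runs through traces: additive maps `End X → V`, one for each object, with `tr (f ≫
g) = tr (g ≫ f)`. On an abelian category a trace defined on all objects kills nilpotent
endomorphisms, because `f` and its restriction to the image of `f` have the same trace and the
restriction has smaller nilpotency index. A trace on `T` extends to `E` through `K ⟶ M ⟶ X` with
`K`, `M` in `T` (trace of a lift on `M` minus trace on `K`), then to the projectives of `mod E` by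
Yoneda, then to all of `mod E` by induction on projective dimension. Hence every trace on `T` kills
nilpotent endomorphisms (`IsClusterTilting.trace_eq_zero`), and radical endomorphisms are nilpotent.

No loops: if `f : X ⟶ X` were radical but not in rad² of `T`, a functional on `End X` that kills
rad² and not `f`, continued by zero to the other indecomposables, would be a trace that does not
kill the nilpotent `f`.

No 2-cycles: for `a : X ⟶ Y` and `b : Y ⟶ X` outside rad², choose functionals `α`, `β` that kill
rad² but not `a`, `b`. One wants a trace with value `α u * β v` on `u ≫ v` and zero on paths of
length two avoiding `Y`. It is well defined because there are no relations from `X` to itself.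
Indeed, Serre duality for `Σ²` gives, for `X` not projective, a sequence `X ⟶ B₁ ⟶ B ⟶ X` spliced
from two conflations, with `B₁`, `B` in `T` and almost split at both ends
(`exists_rightAlmostSplit`, `exists_leftAlmostSplit`). A relation `a ≫ p = 0` with `a : X ⟶ B`
radical comes from a map `X ⟶ B₁`, which must be radical since there are no loops; so the relation
has no effect on the pairing (`exists_functional`). The trace is then nonzero on the nilpotent `a ≫
b`, a contradiction.

Finally, vertices of the quiver of `T/P` are represented by non-projective local objects of `T`, and
a morphism in rad² of `T` is in rad² of `T/P`. -/

namespace FrobeniusCT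

/-! ### The radical of a preadditive category -/

section Radical

variable {C : Type u} [Category.{v} C] [Preadditive C]

theorem isIso_id_sub_swap {X Y : C} (f : X ⟶ Y) (g : Y ⟶ X) (h : IsIso (𝟙 X - f ≫ g)) :
    IsIso (𝟙 Y - g ≫ f) := by
  obtain ⟨a, h₁, h₂⟩ := h
  simp only [Preadditive.sub_comp, Preadditive.comp_sub, Category.id_comp, Category.comp_id,
    Category.assoc] at h₁ h₂
  have h₁' : f ≫ g ≫ a = a - 𝟙 X := by rw [← h₁]; abel
  have h₂' : a ≫ f ≫ g = a - 𝟙 X := by rw [← h₂]; abel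
  -- The usual ring identity: if `a` inverts `1 - fg`, then `1 + gaf` inverts `1 - gf`.
  refine ⟨𝟙 Y + g ≫ a ≫ f, ?_, ?_⟩
  · have : g ≫ f ≫ g ≫ a ≫ f = g ≫ a ≫ f - g ≫ f := by
      have := congrArg (fun x => g ≫ x ≫ f) h₁'
      simpa using this
    simp [this]
  · have : g ≫ a ≫ f ≫ g ≫ f = g ≫ a ≫ f - g ≫ f := by
      have := congrArg (fun x => g ≫ x ≫ f) h₂'
      simpa using this
    simp [this]

theorem InRad.comp_right {X Y Z : C} {f : X ⟶ Y} (hf : InRad f) (g : Y ⟶ Z) : InRad (f ≫ g) :=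
  fun h => by simpa using hf (g ≫ h)

theorem InRad.comp_left {X Y Z : C} (f : X ⟶ Y) {g : Y ⟶ Z} (hg : InRad g) : InRad (f ≫ g) :=
  fun h => by
    simpa using isIso_id_sub_swap (g ≫ h) f (by simpa using hg (h ≫ f))

theorem InRad.add {X Y : C} {f f' : X ⟶ Y} (hf : InRad f) (hf' : InRad f') : InRad (f + f') := by
  intro g
  have h₁ := hf g
  have h₂ : IsIso (𝟙 X - f' ≫ g ≫ inv (𝟙 X - f ≫ g)) := hf' _
  have e : 𝟙 X - (f + f') ≫ g
      = (𝟙 X - f' ≫ g ≫ inv (𝟙 X - f ≫ g)) ≫ (𝟙 X - f ≫ g) := by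
    rw [Preadditive.sub_comp, Category.assoc, Category.assoc, IsIso.inv_hom_id, Category.comp_id,
      Category.id_comp, Preadditive.add_comp]
    abel
  rw [e]
  infer_instance

theorem inRad_zero (X Y : C) : InRad (0 : X ⟶ Y) := fun g => by
  simpa using (inferInstance : IsIso (𝟙 X))

theorem InRad.neg {X Y : C} {f : X ⟶ Y} (hf : InRad f) : InRad (-f) := by
  simpa using hf.comp_right (-𝟙 Y)

theorem InRad.sub {X Y : C} {f f' : X ⟶ Y} (hf : InRad f) (hf' : InRad f') : InRad (f - f') := by
  simpa [sub_eq_add_neg] using hf.add hf'.neg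

theorem InRad.smul {k : Type w} [Field k] [Linear k C] {X Y : C} {f : X ⟶ Y} (hf : InRad f)
    (c : k) : InRad (c • f) := by
  simpa using hf.comp_right (c • 𝟙 Y)

/-- The radical as a subspace of the space of morphisms. -/
def radSubmodule (k : Type w) [Field k] [Linear k C] (X Y : C) : Submodule k (X ⟶ Y) where
  carrier := {f | InRad f}
  add_mem' := InRad.add
  zero_mem' := inRad_zero X Y
  smul_mem' c _ hf := InRad.smul hf c

/-- The morphisms that are composites of two radical morphisms through an object of `T`. -/
def RadSqThrough (T : ObjectProperty C) {X Y : C} (f : X ⟶ Y) : Prop :=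
  ∃ (Z : C) (g : X ⟶ Z) (h : Z ⟶ Y), T Z ∧ InRad g ∧ InRad h ∧ f = g ≫ h

theorem InRad.of_biprod_lift [HasBinaryBiproducts C] {X Y Z : C} {f : X ⟶ Y} {g : X ⟶ Z}
    (hf : InRad f) (hg : InRad g) : InRad (biprod.lift f g) := by
  have : biprod.lift f g = f ≫ biprod.inl + g ≫ biprod.inr := by ext <;> simp
  rw [this]
  exact (hf.comp_right _).add (hg.comp_right _)

theorem InRad.of_biprod_desc [HasBinaryBiproducts C] {X Y Z : C} {f : Y ⟶ X} {g : Z ⟶ X}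
    (hf : InRad f) (hg : InRad g) : InRad (biprod.desc f g) := by
  have : biprod.desc f g = biprod.fst ≫ f + biprod.snd ≫ g := by ext <;> simp
  rw [this]
  exact (hf.comp_left _).add (hg.comp_left _)

/-- The composites of two radical morphisms through `T` form a subspace, when `T` is closed under
direct sums. -/
def radSqSubmodule (k : Type w) [Field k] [Linear k C] [HasBinaryBiproducts C]
    (T : ObjectProperty C) (hT : ∀ Y Z, T Y → T Z → T (Y ⊞ Z)) {W : C} (hW : T W) (X Y : C) :
    Submodule k (X ⟶ Y) where
  carrier := {f | RadSqThrough T f}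
  add_mem' := by
    rintro _ _ ⟨Z, g, h, hZ, hg, hh, rfl⟩ ⟨Z', g', h', hZ', hg', hh', rfl⟩
    exact ⟨Z ⊞ Z', biprod.lift g g', biprod.desc h h', hT _ _ hZ hZ', hg.of_biprod_lift hg',
      hh.of_biprod_desc hh', by simp⟩
  zero_mem' := ⟨W, 0, 0, hW, inRad_zero _ _, inRad_zero _ _, by simp⟩
  smul_mem' := by
    rintro c _ ⟨Z, g, h, hZ, hg, hh, rfl⟩
    exact ⟨Z, c • g, h, hZ, hg.smul c, hh, by simp⟩

end Radical

/-! ### Objects with local endomorphism ring -/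

section LocalObjects

variable {C : Type u} [Category.{v} C] [Preadditive C]

theorem isIso_or_isIso_of_add_eq_id {X : C} (hX : IsLocalRing (End X)) {f g : X ⟶ X}
    (h : f + g = 𝟙 X) : IsIso f ∨ IsIso g := by
  have := hX.isUnit_or_isUnit_of_add_one (a := End.of f) (b := End.of g) h
  simpa only [isUnit_iff_isIso] using this

theorem id_ne_zero_of_isLocalRing {X : C} (hX : IsLocalRing (End X)) : 𝟙 X ≠ 0 :=
  fun h => one_ne_zero (α := End X) h

/-- A one-sided inverse between a local object and a nonzero one is two-sided. -/
theorem isIso_of_comp_eq_id {X Y : C} (hY : IsLocalRing (End Y)) {f : X ⟶ Y} {g : Y ⟶ X}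
    (h : f ≫ g = 𝟙 X) (hX : 𝟙 X ≠ 0) : IsIso f := by
  have key : g ≫ f = 𝟙 Y := by
    rcases isIso_or_isIso_of_add_eq_id hY (f := g ≫ f) (g := 𝟙 Y - g ≫ f) (by abel) with h' | h'
    · rw [← cancel_epi (g ≫ f)]
      simp [reassoc_of% h]
    · exfalso
      apply hX
      have h0 : (g ≫ f) ≫ (𝟙 Y - g ≫ f) = 0 := by simp [reassoc_of% h]
      have h1 : g ≫ f = 0 := by rw [← cancel_mono (𝟙 Y - g ≫ f), h0, zero_comp]
      have : f ≫ (g ≫ f) ≫ g = 𝟙 X := by simp [h]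
      rw [← this, h1]; simp
  exact ⟨g, h, key⟩

theorem inRad_of_forall_not_isIso {X Y : C} (hX : IsLocalRing (End X)) {f : X ⟶ Y}
    (h : ∀ g : Y ⟶ X, ¬ IsIso (f ≫ g)) : InRad f := fun g =>
  (isIso_or_isIso_of_add_eq_id hX (f := f ≫ g) (g := 𝟙 X - f ≫ g) (by abel)).resolve_left (h g)

theorem inRad_of_forall_not_isIso' {X Y : C} (hX : IsLocalRing (End X)) {f : Y ⟶ X}
    (h : ∀ g : X ⟶ Y, ¬ IsIso (g ≫ f)) : InRad f := fun g =>
  isIso_id_sub_swap g f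
    ((isIso_or_isIso_of_add_eq_id hX (f := g ≫ f) (g := 𝟙 X - g ≫ f) (by abel)).resolve_left (h g))

theorem InRad.not_isIso {X Y : C} {f : X ⟶ Y} (hf : InRad f) (hX : 𝟙 X ≠ 0) : ¬ IsIso f := by
  intro h
  have := hf (inv f)
  rw [IsIso.hom_inv_id, sub_self] at this
  apply hX
  rw [← IsIso.hom_inv_id (0 : X ⟶ X), zero_comp]

theorem inRad_iff_not_isIso {X : C} (hX : IsLocalRing (End X)) (f : X ⟶ X) :
    InRad f ↔ ¬ IsIso f := by
  refine ⟨fun h => h.not_isIso (id_ne_zero_of_isLocalRing hX), fun h => ?_⟩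
  refine inRad_of_forall_not_isIso hX fun g hg => h ?_
  exact isIso_of_comp_eq_id hX (g := g ≫ inv (f ≫ g))
    (by rw [← Category.assoc, IsIso.hom_inv_id]) (id_ne_zero_of_isLocalRing hX)

theorem exists_comp_eq_id_of_not_inRad {X Y : C} (hX : IsLocalRing (End X)) {f : X ⟶ Y}
    (hf : ¬ InRad f) : ∃ g : Y ⟶ X, f ≫ g = 𝟙 X := by
  by_contra! h
  refine hf (inRad_of_forall_not_isIso hX fun g hg => h (g ≫ inv (f ≫ g)) ?_)
  rw [← Category.assoc, IsIso.hom_inv_id]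

theorem exists_comp_eq_id_of_not_inRad' {X Y : C} (hX : IsLocalRing (End X)) {f : Y ⟶ X}
    (hf : ¬ InRad f) : ∃ g : X ⟶ Y, g ≫ f = 𝟙 X := by
  by_contra! h
  refine hf (inRad_of_forall_not_isIso' hX fun g hg => h (inv (g ≫ f) ≫ g) ?_)
  rw [Category.assoc, IsIso.inv_hom_id]

theorem inRad_of_isEmpty_iso {X Y : C} (hX : IsLocalRing (End X)) (hY : IsLocalRing (End Y))
    (h : IsEmpty (X ≅ Y)) (f : X ⟶ Y) : InRad f := by
  by_contra hf
  obtain ⟨g, hg⟩ := exists_comp_eq_id_of_not_inRad hX hf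
  have := isIso_of_comp_eq_id hY hg (id_ne_zero_of_isLocalRing hX)
  exact h.false (asIso f)

variable {k : Type w} [Field k] [IsAlgClosed k] [Linear k C]

/-- Over an algebraically closed field `f` has an eigenvalue `c`; then `f - c` is not invertible,
hence radical. So `End X = k ⊕ rad`. -/
theorem exists_sub_smul_id_inRad {X : C} (hX : IsLocalRing (End X)) [Module.Finite k (X ⟶ X)]
    (f : X ⟶ X) : ∃ c : k, InRad (f - c • 𝟙 X) := by
  have : FiniteDimensional k (End X) := inferInstanceAs (Module.Finite k (X ⟶ X))
  have := hX.toNontrivial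
  obtain ⟨c, hc⟩ := spectrum.nonempty_of_isAlgClosed_of_finiteDimensional k (End.of f)
  refine ⟨c, (inRad_iff_not_isIso hX _).2 fun h => ?_⟩
  rw [spectrum.mem_iff, ← IsUnit.neg_iff, isUnit_iff_isIso, neg_sub] at hc
  apply hc
  rw [Algebra.algebraMap_eq_smul_one]
  exact h

/-- The residue map `End X ⟶ End X / rad = k` of a local object. -/
theorem exists_residue (k : Type w) [Field k] [IsAlgClosed k] [Linear k C] {X : C}
    (hX : IsLocalRing (End X)) [Module.Finite k (X ⟶ X)] :
    ∃ r : (X ⟶ X) →ₗ[k] k, r (𝟙 X) = 1 ∧ ∀ f, r f = 0 ↔ InRad f := by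
  have h1 : 𝟙 X ∉ radSubmodule k X X := fun h =>
    InRad.not_isIso h (id_ne_zero_of_isLocalRing hX) inferInstance
  obtain ⟨φ, hφ, hφ'⟩ := Submodule.exists_le_ker_of_notMem h1
  refine ⟨(φ (𝟙 X))⁻¹ • φ, by simp [hφ], fun f => ?_⟩
  simp only [LinearMap.smul_apply, smul_eq_mul, mul_eq_zero, inv_eq_zero, hφ, false_or]
  refine ⟨fun h => ?_, fun h => hφ' h⟩
  obtain ⟨c, hc⟩ := exists_sub_smul_id_inRad (k := k) hX f
  have h2 : φ (f - c • 𝟙 X) = 0 := hφ' hc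
  rw [map_sub, h, zero_sub, neg_eq_zero, map_smul, smul_eq_mul, mul_eq_zero] at h2
  rw [h2.resolve_right hφ] at hc
  simpa using hc

/-- Radical endomorphisms of a local object with finite dimensional endomorphism ring are
nilpotent. -/
theorem InRad.isNilpotent {X : C} [Module.Finite k (X ⟶ X)]
    {f : X ⟶ X} (hf : InRad f) : IsNilpotent (End.of f) := by
  have : FiniteDimensional k (End X) := inferInstanceAs (Module.Finite k (X ⟶ X))
  -- Zero is the only possible eigenvalue of `f`: `f - c = -c (1 - c⁻¹ f)` is invertible for `c ≠
  -- 0`.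
  have hr : ∀ c : k, c ≠ 0 → IsUnit (End.of f - algebraMap k (End X) c) := by
    intro c hc
    have h := hf (c⁻¹ • 𝟙 X)
    have e : f - c • 𝟙 X = (𝟙 X - f ≫ (c⁻¹ • 𝟙 X)) ≫ (-c • 𝟙 X) := by
      rw [neg_smul, Preadditive.comp_neg, Linear.comp_smul, Category.comp_id, smul_sub,
        Linear.comp_smul, Category.comp_id, smul_smul, mul_inv_cancel₀ hc, one_smul, neg_sub]
    have h' : IsIso (-c • 𝟙 X : X ⟶ X) :=
      ⟨-c⁻¹ • 𝟙 X, by simp [smul_smul, hc], by simp [smul_smul, hc]⟩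
    rw [isUnit_iff_isIso, Algebra.algebraMap_eq_smul_one]
    change IsIso (f - c • 𝟙 X)
    rw [e]
    infer_instance
  have hp := minpoly.aeval k (End.of f)
  have hs := (IsAlgClosed.splits (minpoly k (End.of f))).eq_prod_roots_of_monic
    (minpoly.monic (Algebra.IsIntegral.isIntegral (R := k) (End.of f)))
  rw [hs] at hp
  clear hs
  generalize (minpoly k (End.of f)).roots = s at hp
  -- The split minimal polynomial is dismantled root by root: a factor with nonzero root is a unit
  -- and is cancelled, a zero root is absorbed into the power `n` of `f`.
  have key : ∀ (s : Multiset k) (n : ℕ),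
      (End.of f) ^ n * Polynomial.aeval (End.of f)
        (s.map fun a => Polynomial.X - Polynomial.C a).prod = 0 → IsNilpotent (End.of f) := by
    intro s
    induction s using Multiset.induction with
    | empty => intro n h; exact ⟨n, by simpa using h⟩
    | cons a s ih =>
      intro n h
      simp only [Multiset.map_cons, Multiset.prod_cons, map_mul, map_sub, Polynomial.aeval_X,
        Polynomial.aeval_C] at h
      by_cases ha : a = 0
      · subst ha
        exact ih (n + 1) (by rw [pow_succ, mul_assoc]; simpa using h)
      · refine ih n ?_
        have hc : Commute (End.of f ^ n) (End.of f - algebraMap k (End X) a) :=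
          (((Commute.refl _).sub_right (Algebra.commutes a (End.of f)).symm).pow_left n)
        rw [← mul_assoc, hc.eq, mul_assoc] at h
        exact (hr a ha).mul_right_eq_zero.1 h
  exact key s 0 (by simpa using hp)

end LocalObjects

/-! ### Traces and their extension to larger classes of objects -/

section Trace

variable {C : Type u} [Category.{v} C] [Preadditive C]

/-- A trace on the objects in `D` with values in an abelian group: additive maps on endomorphism
groups satisfying `tr (f g) = tr (g f)`. -/
structure TraceOn (D : ObjectProperty C) (V : Type w) [AddCommGroup V] where
  val : ∀ X : C, (X ⟶ X) →+ V
  comm : ∀ X Y : C, D X → D Y → ∀ (f : X ⟶ Y) (g : Y ⟶ X), val X (f ≫ g) = val Y (g ≫ f)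

/-- `Z` is a retract of a finite direct sum of objects in `D`. -/
def IsSumRetract (D : ObjectProperty C) : ObjectProperty C := fun Z =>
  ∃ (n : ℕ) (Y : Fin n → C) (ι : ∀ l, Y l ⟶ Z) (π : ∀ l, Z ⟶ Y l),
    (∀ l, D (Y l)) ∧ ∑ l, π l ≫ ι l = 𝟙 Z

variable {V : Type w} [AddCommGroup V]

/-- The trace of `f` is the sum of its diagonal entries `ι l ≫ f ≫ π l`; inserting `∑ π l ≫ ι l = 𝟙`
gives the trace property. Objects outside the class get the value 0, which is harmless since `comm`
is asked only inside it. -/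
theorem TraceOn.exists_extend_sumRetract {D : ObjectProperty C} (τ : TraceOn D V) :
    ∃ τ' : TraceOn (IsSumRetract D) V, ∀ X, D X → ∀ f, τ'.val X f = τ.val X f := by
  classical
  have key : ∀ Z : C, ∃ φ : (Z ⟶ Z) →+ V, IsSumRetract D Z →
      ∃ (n : ℕ) (Y : Fin n → C) (ι : ∀ l, Y l ⟶ Z) (π : ∀ l, Z ⟶ Y l),
        (∀ l, D (Y l)) ∧ ∑ l, π l ≫ ι l = 𝟙 Z ∧
        ∀ f, φ f = ∑ l, τ.val (Y l) (ι l ≫ f ≫ π l) := by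
    intro Z
    by_cases h : IsSumRetract D Z
    · obtain ⟨n, Y, ι, π, hD, hs⟩ := h
      refine ⟨AddMonoidHom.mk' (fun f => ∑ l, τ.val (Y l) (ι l ≫ f ≫ π l)) fun f g => ?_,
        fun _ => ⟨n, Y, ι, π, hD, hs, fun f => rfl⟩⟩
      simp [Finset.sum_add_distrib]
    · exact ⟨0, fun h' => (h h').elim⟩
  choose φ hφ using key
  refine ⟨⟨φ, fun X Z hX hZ f g => ?_⟩, fun X hX f => ?_⟩
  · obtain ⟨n, Y, ι, π, hY, hs, hf⟩ := hφ X hX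
    obtain ⟨n', Y', ι', π', hY', hs', hf'⟩ := hφ Z hZ
    rw [hf, hf']
    have e₁ : ∀ l, τ.val (Y l) (ι l ≫ (f ≫ g) ≫ π l)
        = ∑ l', τ.val (Y l) ((ι l ≫ f ≫ π' l') ≫ (ι' l' ≫ g ≫ π l)) := fun l => by
      rw [← map_sum]
      congr 1
      calc ι l ≫ (f ≫ g) ≫ π l = (ι l ≫ f) ≫ (∑ l', π' l' ≫ ι' l') ≫ g ≫ π l := by simp [hs']
        _ = _ := by simp [Preadditive.sum_comp, Preadditive.comp_sum]
    have e₂ : ∀ l', τ.val (Y' l') (ι' l' ≫ (g ≫ f) ≫ π' l')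
        = ∑ l, τ.val (Y' l') ((ι' l' ≫ g ≫ π l) ≫ (ι l ≫ f ≫ π' l')) := fun l' => by
      rw [← map_sum]
      congr 1
      calc ι' l' ≫ (g ≫ f) ≫ π' l' = (ι' l' ≫ g) ≫ (∑ l, π l ≫ ι l) ≫ f ≫ π' l' := by simp [hs]
        _ = _ := by simp [Preadditive.sum_comp, Preadditive.comp_sum]
    rw [Finset.sum_congr rfl fun l _ => e₁ l, Finset.sum_congr rfl fun l _ => e₂ l,
      Finset.sum_comm]
    exact Finset.sum_congr rfl fun l' _ => Finset.sum_congr rfl fun l _ =>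
      τ.comm _ _ (hY l) (hY' l') _ _
  · obtain ⟨n, Y, ι, π, hY, hs, hf⟩ := hφ X ⟨1, fun _ => X, fun _ => 𝟙 X, fun _ => 𝟙 X,
      fun _ => hX, by simp⟩
    change φ X f = _
    rw [hf]
    calc ∑ l, τ.val (Y l) (ι l ≫ f ≫ π l) = ∑ l, τ.val X (f ≫ π l ≫ ι l) :=
          Finset.sum_congr rfl fun l _ => by rw [τ.comm _ _ (hY l) hX, Category.assoc]
      _ = τ.val X f := by
          rw [← map_sum, ← Preadditive.comp_sum, hs, Category.comp_id]

/-- `F` has a presentation `K ⟶ P ⟶ F` with `K` in `D`, where `P ⟶ F` is a right `Q`-approximation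
with kernel `K`. -/
def HasApproxPresentation (D Q : ObjectProperty C) : ObjectProperty C := fun F =>
  ∃ (K P : C) (i : K ⟶ P) (p : P ⟶ F), D K ∧ Q P ∧ i ≫ p = 0 ∧
    (∀ (W : C) (a : W ⟶ P), a ≫ p = 0 → ∃ b, b ≫ i = a) ∧ Mono i ∧
    (∀ (M : C), Q M → ∀ a : M ⟶ F, ∃ b : M ⟶ P, b ≫ p = a)

/-- An Euler characteristic: the trace of `f` is that of a lift to `P` minus that of the induced map
on `K`. It serves twice, for projective presentations in `mod E` and for `T`-approximations in `E`.
-/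
theorem TraceOn.exists_extend_approxPresentation {D Q : ObjectProperty C} (hQ : ∀ X, Q X → D X)
    (τ : TraceOn D V) :
    ∃ τ' : TraceOn (HasApproxPresentation D Q) V, ∀ X, Q X → HasApproxPresentation D Q X →
      ∀ f, τ'.val X f = τ.val X f := by
  classical
  have key : ∀ F : C, ∃ φ : (F ⟶ F) →+ V, HasApproxPresentation D Q F →
      ∃ (K P : C) (i : K ⟶ P) (p : P ⟶ F), D K ∧ Q P ∧ i ≫ p = 0 ∧
        (∀ (W : C) (a : W ⟶ P), a ≫ p = 0 → ∃ b, b ≫ i = a) ∧ Mono i ∧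
        (∀ (M : C), Q M → ∀ a : M ⟶ F, ∃ b : M ⟶ P, b ≫ p = a) ∧
        (∀ (f : F ⟶ F) (f₀ : P ⟶ P) (f₁ : K ⟶ K), f₀ ≫ p = p ≫ f → f₁ ≫ i = i ≫ f₀ →
          φ f = τ.val P f₀ - τ.val K f₁) := by
    intro F
    by_cases h : HasApproxPresentation D Q F
    · obtain ⟨K, P, i, p, hK, hP, w, hker, hi, hl⟩ := h
      have h0 : ∀ f : F ⟶ F, ∃ f₀ : P ⟶ P, f₀ ≫ p = p ≫ f := fun f => hl P hP _
      choose l₀ hl₀ using h0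
      have h1 : ∀ f : F ⟶ F, ∃ f₁ : K ⟶ K, f₁ ≫ i = i ≫ l₀ f := fun f =>
        hker _ _ (by rw [Category.assoc, hl₀, reassoc_of% w, zero_comp])
      choose l₁ hl₁ using h1
      -- Two lifts differ by `s ≫ i` on `P` and by `i ≫ s` on `K` for some `s : P ⟶ K`; these have
      -- the same trace, so the difference of traces does not depend on the lift.
      have uniq : ∀ (f : F ⟶ F) (f₀ : P ⟶ P) (f₁ : K ⟶ K), f₀ ≫ p = p ≫ f → f₁ ≫ i = i ≫ f₀ →
          τ.val P (l₀ f) - τ.val K (l₁ f) = τ.val P f₀ - τ.val K f₁ := by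
        intro f f₀ f₁ e₀ e₁
        obtain ⟨s, hs⟩ := hker P (l₀ f - f₀) (by rw [Preadditive.sub_comp, hl₀, e₀, sub_self])
        have hs' : i ≫ s = l₁ f - f₁ := by
          rw [← cancel_mono i, Category.assoc, hs, Preadditive.comp_sub, Preadditive.sub_comp,
            hl₁, e₁]
        have := τ.comm _ _ (hQ _ hP) hK s i
        rw [hs, hs', map_sub, map_sub] at this
        rw [sub_eq_sub_iff_sub_eq_sub]
        exact this
      refine ⟨AddMonoidHom.mk' (fun f => τ.val P (l₀ f) - τ.val K (l₁ f)) fun f g => ?_,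
        fun _ => ⟨K, P, i, p, hK, hP, w, hker, hi, hl, uniq⟩⟩
      rw [uniq (f + g) (l₀ f + l₀ g) (l₁ f + l₁ g) (by simp [hl₀]) (by simp [hl₁])]
      simp only [map_add]
      abel
    · exact ⟨0, fun h' => (h h').elim⟩
  choose φ hφ using key
  refine ⟨⟨φ, fun X Y hX hY f g => ?_⟩, fun X hX hX' f => ?_⟩
  · obtain ⟨K, P, i, p, hK, hP, w, hker, hi, hl, hv⟩ := hφ X hX
    obtain ⟨K', P', i', p', hK', hP', w', hker', hi', hl', hv'⟩ := hφ Y hY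
    obtain ⟨f₀, hf₀⟩ := hl' P hP (p ≫ f)
    obtain ⟨g₀, hg₀⟩ := hl P' hP' (p' ≫ g)
    obtain ⟨f₁, hf₁⟩ := hker' K (i ≫ f₀) (by rw [Category.assoc, hf₀, reassoc_of% w, zero_comp])
    obtain ⟨g₁, hg₁⟩ := hker K' (i' ≫ g₀) (by rw [Category.assoc, hg₀, reassoc_of% w', zero_comp])
    rw [hv (f ≫ g) (f₀ ≫ g₀) (f₁ ≫ g₁) (by simp [hg₀, reassoc_of% hf₀])
        (by simp [hg₁, reassoc_of% hf₁]),
      hv' (g ≫ f) (g₀ ≫ f₀) (g₁ ≫ f₁) (by simp [hf₀, reassoc_of% hg₀])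
        (by simp [hf₁, reassoc_of% hg₁]),
      τ.comm _ _ (hQ _ hP) (hQ _ hP'), τ.comm _ _ hK hK']
  · obtain ⟨K, P, i, p, hK, hP, w, hker, hi, hl, hv⟩ := hφ X hX'
    obtain ⟨s, hs⟩ := hl X hX (𝟙 X)
    change φ X f = _
    rw [hv f (p ≫ f ≫ s) 0 (by simp [hs]) (by simp [reassoc_of% w]), map_zero, sub_zero,
      τ.comm _ _ (hQ _ hP) (hQ _ hX), Category.assoc, hs, Category.comp_id]

end Trace

/-! ### Traces on abelian categories -/

section AbelianTrace

variable {A : Type u} [Category.{v} A] [Abelian A] {V : Type w} [AddCommGroup V]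

/-- Induction on `n`: the kernel of a projective cover term has projective dimension one less, so
the trace passes along the presentation by the Euler characteristic. -/
theorem TraceOn.exists_extend_projectiveDimension [EnoughProjectives A]
    (τ : TraceOn (fun X : A => Projective X) V) (n : ℕ) :
    ∃ τ' : TraceOn (fun X : A => HasProjectiveDimensionLE X n) V,
      ∀ X, Projective X → ∀ f, τ'.val X f = τ.val X f := by
  induction n with
  | zero =>
    refine ⟨⟨τ.val, fun X Y hX hY => τ.comm X Y ?_ ?_⟩, fun _ _ _ => rfl⟩
    · exact (projective_iff_hasProjectiveDimensionLE_zero _).2 hX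
    · exact (projective_iff_hasProjectiveDimensionLE_zero _).2 hY
  | succ n ih =>
    obtain ⟨τ₁, h₁⟩ := ih
    have hQ : ∀ X : A, Projective X → HasProjectiveDimensionLE X n := fun X _ =>
      hasProjectiveDimensionLT_of_ge X 1 (n + 1) (by omega)
    have hpres : ∀ X : A, HasProjectiveDimensionLE X (n + 1) →
        HasApproxPresentation (fun X : A => HasProjectiveDimensionLE X n)
          (fun X : A => Projective X) X := by
      intro X hX
      have hS : (ShortComplex.mk (kernel.ι (Projective.π X)) (Projective.π X)
        (kernel.condition _)).ShortExact := { exact := ShortComplex.exact_kernel _ }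
      refine ⟨kernel (Projective.π X), Projective.over X, kernel.ι _, Projective.π X,
        (hS.hasProjectiveDimensionLT_X₃_iff n (inferInstanceAs (Projective (Projective.over X)))).1
          hX, inferInstanceAs (Projective (Projective.over X)), kernel.condition _,
        fun W a ha => ⟨kernel.lift _ a ha, by simp⟩, inferInstance, fun M hM a => ?_⟩
      have : Projective M := hM
      exact ⟨Projective.factorThru a (Projective.π X), by simp⟩
    obtain ⟨τ₂, h₂⟩ := τ₁.exists_extend_approxPresentation hQ
    refine ⟨⟨τ₂.val, fun X Y hX hY => τ₂.comm X Y (hpres X hX) (hpres Y hY)⟩, fun X hX f => ?_⟩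
    rw [← h₁ X hX]
    exact h₂ X hX (hpres X (hasProjectiveDimensionLT_of_ge X 1 (n + 2) (by omega))) f

/-- A trace defined on all objects of an abelian category vanishes on nilpotent endomorphisms. -/
theorem TraceOn.val_eq_zero_of_pow_eq_zero {D : ObjectProperty A} (hD : ∀ X, D X)
    (τ : TraceOn D V) (n : ℕ) (X : A) (f : X ⟶ X) (hf : End.of f ^ n = 0) : τ.val X f = 0 := by
  induction n generalizing X with
  | zero =>
    have : 𝟙 X = 0 := hf
    have hf0 : f = 0 := by rw [← Category.id_comp f, this, zero_comp]
    rw [hf0, map_zero]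
  | succ n ih =>
    -- With `f = e ≫ m` through its image, `f` has the trace of `m ≫ e`. Since `e ≫ (m ≫ e)^n ≫ m =
    -- f^(n+1)` with `e` epi and `m` mono, the nilpotency index drops.
    have hfac : Abelian.factorThruImage f ≫ Abelian.image.ι f = f := Abelian.image.fac f
    rw [← hfac, τ.comm _ _ (hD _) (hD _)]
    apply ih
    have hp : ∀ m : ℕ, Abelian.factorThruImage f ≫
        (End.of (Abelian.image.ι f ≫ Abelian.factorThruImage f) ^ m : End _) =
        (End.of f ^ m : End X) ≫ Abelian.factorThruImage f := by
      intro m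
      induction m with
      | zero => rw [pow_zero, pow_zero, End.one_def, End.one_def, Category.comp_id,
          Category.id_comp]
      | succ m ihm =>
        rw [pow_succ', pow_succ', End.mul_def, End.mul_def, reassoc_of% ihm, Category.assoc]
        congr 1
        exact (Category.assoc _ _ _).symm.trans (congrArg (· ≫ Abelian.factorThruImage f) hfac)
    have h0 : Abelian.factorThruImage f ≫
        (End.of (Abelian.image.ι f ≫ Abelian.factorThruImage f) ^ n : End _) ≫
          Abelian.image.ι f = 0 := by
      rw [← Category.assoc, hp, Category.assoc, hfac]
      rw [pow_succ', End.mul_def] at hf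
      exact hf
    rw [← cancel_mono (Abelian.image.ι f), ← cancel_epi (Abelian.factorThruImage f), h0]
    exact (by rw [zero_comp, comp_zero])

end AbelianTrace

/-! ### Finitely presented functors -/

section FinPres

variable {C : Type u} [Category.{v} C] [Preadditive C]

instance additive_preadditiveYoneda :
    (preadditiveYoneda : C ⥤ Cᵒᵖ ⥤ AddCommGrpCat.{v}).Additive where
  map_add {X Y f g} := by
    ext W a
    exact Preadditive.comp_add _ _ _ (a : W.unop ⟶ X) f g

/-- Epimorphisms of functors are pointwise surjective, so by the Yoneda lemma representables lift
along them; by fullness the lift is again a morphism of `C`. -/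
theorem exists_yoneda_map_comp_eq {X Z : C} {G : Cᵒᵖ ⥤ AddCommGrpCat.{v}}
    (r : preadditiveYoneda.obj Z ⟶ G) [Epi r] (a : preadditiveYoneda.obj X ⟶ G) :
    ∃ z : X ⟶ Z, preadditiveYoneda.map z ≫ r = a := by
  have h := (AddCommGrpCat.epi_iff_surjective _).1 (inferInstance : Epi (r.app (.op X)))
  obtain ⟨z, hz⟩ := h ((a.app (.op X)).hom (𝟙 X : X ⟶ X))
  refine ⟨(z : X ⟶ Z), ?_⟩
  ext W g
  have h₁ := ConcreteCategory.congr_hom (r.naturality (Quiver.Hom.op (g : W.unop ⟶ X))) z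
  have h₂ := ConcreteCategory.congr_hom (a.naturality (Quiver.Hom.op (g : W.unop ⟶ X)))
    (𝟙 X : X ⟶ X)
  have h₃ : (a.app W).hom (g ≫ 𝟙 X : W.unop ⟶ X)
      = (G.map (Quiver.Hom.op (g : W.unop ⟶ X))).hom ((a.app (.op X)).hom (𝟙 X : X ⟶ X)) := h₂
  have h₄ : (a.app W).hom (g : W.unop ⟶ X) = (a.app W).hom (g ≫ 𝟙 X : W.unop ⟶ X) :=
    congrArg (fun b : W.unop ⟶ X => (a.app W).hom b) (Category.comp_id _).symm
  rw [← hz] at h₃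
  exact h₁.trans (h₄.trans h₃).symm

theorem isFinPres_yoneda (X : C) : isFinPres C (preadditiveYoneda.obj X) :=
  ⟨X, X, 0, ⟨cokernelZeroIsoTarget.symm ≪≫
    cokernelIsoOfEq (preadditiveYoneda.map_zero X X).symm⟩⟩

/-- The Yoneda embedding into the category of finitely presented functors. -/
abbrev yonedaFinPres (C : Type u) [Category.{v} C] [Preadditive C] : C ⥤ ModCat C :=
  (isFinPres C).lift preadditiveYoneda isFinPres_yoneda

theorem exists_epi_from_yoneda (F : ModCat C) :
    ∃ (Z : C) (r : preadditiveYoneda.obj Z ⟶ F.obj), Epi r := by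
  obtain ⟨X, Y, f, ⟨e⟩⟩ := F.property
  exact ⟨Y, cokernel.π _ ≫ e.inv, inferInstance⟩

/-- Being epi in `mod C` is a priori weaker than being epi in the functor category. The two agree
because the cokernel of `q`, obtained by adding to the relations `f` of `G` the generators `z` of
the image of `F`, is itself finitely presented, so it must vanish. -/
theorem epi_hom_of_epi [HasBinaryBiproducts C] {F G : ModCat C} (q : F ⟶ G) [hq : Epi q] :
    Epi q.hom := by
  obtain ⟨X₁, X₀, f, ⟨e⟩⟩ := G.property
  obtain ⟨Z, r, hr⟩ := exists_epi_from_yoneda F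
  let p : preadditiveYoneda.obj X₀ ⟶ G.obj := cokernel.π _ ≫ e.inv
  have hp : preadditiveYoneda.map f ≫ p = 0 := by simp [p]
  obtain ⟨z, hz⟩ := exists_yoneda_map_comp_eq p (r ≫ q.hom)
  let d : X₁ ⊞ Z ⟶ X₀ := biprod.desc f z
  have hd₁ : preadditiveYoneda.map f ≫ cokernel.π (preadditiveYoneda.map d) = 0 := by
    have : f = biprod.inl ≫ d := by simp [d]
    rw [this, Functor.map_comp, Category.assoc, cokernel.condition, comp_zero]
  have hd₂ : preadditiveYoneda.map z ≫ cokernel.π (preadditiveYoneda.map d) = 0 := by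
    have : z = biprod.inr ≫ d := by simp [d]
    rw [this, Functor.map_comp, Category.assoc, cokernel.condition, comp_zero]
  let H : ModCat C := ⟨cokernel (preadditiveYoneda.map d), _, _, d, ⟨Iso.refl _⟩⟩
  let π : G ⟶ H := ObjectProperty.homMk (e.hom ≫ cokernel.desc _ _ hd₁)
  have hpπ : p ≫ π.hom = cokernel.π (preadditiveYoneda.map d) := by simp [p, π]
  have hqπ : q ≫ π = 0 := by
    apply ObjectProperty.hom_ext
    change q.hom ≫ π.hom = 0
    rw [← cancel_epi r, comp_zero, ← Category.assoc, ← hz, Category.assoc, hpπ, hd₂]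
  have hπ : π = 0 := by rw [← cancel_epi q, hqπ, comp_zero]
  have h0 : cokernel.π (preadditiveYoneda.map d) = 0 := by
    rw [← hpπ, hπ]
    exact comp_zero
  have hepi : Epi (preadditiveYoneda.map d) := Abelian.epi_of_cokernel_π_eq_zero _ h0
  have hfac : preadditiveYoneda.map d ≫ p
      = (preadditiveYoneda.map (biprod.snd : X₁ ⊞ Z ⟶ Z) ≫ r) ≫ q.hom := by
    have : d = biprod.fst ≫ f + biprod.snd ≫ z := by ext <;> simp [d]
    rw [this, Functor.map_add, Functor.map_comp, Functor.map_comp, Preadditive.add_comp,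
      Category.assoc, hp, comp_zero, zero_add, Category.assoc, hz, Category.assoc]
  have : Epi ((preadditiveYoneda.map (biprod.snd : X₁ ⊞ Z ⟶ Z) ≫ r) ≫ q.hom) := by
    rw [← hfac]; infer_instance
  exact epi_of_epi (preadditiveYoneda.map (biprod.snd : X₁ ⊞ Z ⟶ Z) ≫ r) q.hom

theorem projective_yonedaFinPres [HasBinaryBiproducts C] (X : C) :
    Projective ((yonedaFinPres C).obj X) where
  factors {F G} a q hq := by
    obtain ⟨Z, r, hr⟩ := exists_epi_from_yoneda F
    have := epi_hom_of_epi q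
    obtain ⟨z, hz⟩ := exists_yoneda_map_comp_eq (r ≫ q.hom) a.hom
    refine ⟨ObjectProperty.homMk (preadditiveYoneda.map z ≫ r), ?_⟩
    apply ObjectProperty.hom_ext
    rw [← hz]
    exact Category.assoc _ _ _

theorem exists_epi_from_yonedaFinPres (F : ModCat C) :
    ∃ (Z : C) (r : (yonedaFinPres C).obj Z ⟶ F), Epi r := by
  obtain ⟨Z, r, hr⟩ := exists_epi_from_yoneda F
  refine ⟨Z, ObjectProperty.homMk r, ⟨fun a b h => ?_⟩⟩
  apply ObjectProperty.hom_ext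
  rw [← cancel_epi r]
  exact congrArg InducedCategory.Hom.hom h

variable {V : Type w} [AddCommGroup V]

/-- A projective of `mod C` is a retract of a representable, and endomorphisms of representables
come from `C`; conjugating by the retraction defines the trace. -/
theorem TraceOn.exists_extend_projective [HasBinaryBiproducts C] {D : ObjectProperty C}
    (hD : ∀ X, D X) (τ : TraceOn D V) :
    ∃ τ' : TraceOn (fun F : ModCat C => Projective F) V,
      ∀ X f, τ'.val ((yonedaFinPres C).obj X) ((yonedaFinPres C).map f) = τ.val X f := by
  classical
  let y := yonedaFinPres C
  have key : ∀ F : ModCat C, ∃ φ : (F ⟶ F) →+ V, Projective F →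
      ∃ (Y : C) (s : F ⟶ y.obj Y) (r : y.obj Y ⟶ F), s ≫ r = 𝟙 F ∧
        ∀ f, φ f = τ.val Y (y.preimage (r ≫ f ≫ s)) := by
    intro F
    by_cases h : Projective F
    · obtain ⟨Y, r, hr⟩ := exists_epi_from_yonedaFinPres F
      refine ⟨AddMonoidHom.mk' (fun f => τ.val Y (y.preimage
        (r ≫ f ≫ Projective.factorThru (𝟙 F) r))) fun f g => ?_,
        fun _ => ⟨Y, Projective.factorThru (𝟙 F) r, r, by simp, fun f => rfl⟩⟩
      rw [← map_add]
      congr 1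
      apply y.map_injective
      have hadd : ∀ a b : Y ⟶ Y, y.map (a + b) = y.map a + y.map b := fun a b => by
        apply ObjectProperty.hom_ext
        exact preadditiveYoneda.map_add
      simp [hadd]
    · exact ⟨0, fun h' => (h h').elim⟩
  choose φ hφ using key
  have hcomm : ∀ F G : ModCat C, Projective F → Projective G → ∀ (f : F ⟶ G) (g : G ⟶ F),
      φ F (f ≫ g) = φ G (g ≫ f) := by
    intro F G hF hG f g
    obtain ⟨X, s, r, hsr, h⟩ := hφ F hF
    obtain ⟨Y, s', r', hsr', h'⟩ := hφ G hG
    rw [h, h']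
    have e₁ : y.preimage (r ≫ (f ≫ g) ≫ s)
        = y.preimage (r ≫ f ≫ s') ≫ y.preimage (r' ≫ g ≫ s) := by
      apply y.map_injective
      simp [reassoc_of% hsr']
    have e₂ : y.preimage (r' ≫ (g ≫ f) ≫ s')
        = y.preimage (r' ≫ g ≫ s) ≫ y.preimage (r ≫ f ≫ s') := by
      apply y.map_injective
      simp [reassoc_of% hsr]
    rw [e₁, e₂, τ.comm _ _ (hD _) (hD _)]
  refine ⟨⟨φ, hcomm⟩, fun X f => ?_⟩
  obtain ⟨Y, s, r, hsr, h⟩ := hφ (y.obj X) (projective_yonedaFinPres X)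
  change φ (y.obj X) (y.map f) = _
  rw [h]
  have e₁ : y.preimage (r ≫ y.map f ≫ s) = (y.preimage r ≫ f) ≫ y.preimage s := by
    apply y.map_injective
    simp
  have e₂ : y.preimage s ≫ y.preimage r = 𝟙 X := by
    apply y.map_injective
    simp [hsr]
  rw [e₁, τ.comm _ _ (hD _) (hD _), ← Category.assoc, e₂, Category.id_comp]

/-- If the finitely presented functors form an abelian category of finite global dimension, then
every trace on the category vanishes on nilpotent endomorphisms. -/
theorem TraceOn.val_eq_zero_of_finiteGlobalDimension [HasBinaryBiproducts C]
    (hab : IsAbelian (ModCat C)) (hgl : hab.FiniteGlobalDimension) {D : ObjectProperty C}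
    (hD : ∀ X, D X) (τ : TraceOn D V) (X : C) (f : X ⟶ X) (hf : IsNilpotent (End.of f)) :
    τ.val X f = 0 := by
  let _ := hab.toAbelian
  obtain ⟨n, hn⟩ := hgl
  obtain ⟨τ₁, h₁⟩ := τ.exists_extend_projective hD
  have : EnoughProjectives (ModCat C) := ⟨fun F => by
    obtain ⟨Z, r, hr⟩ := exists_epi_from_yonedaFinPres F
    have := projective_yonedaFinPres Z
    exact ⟨{ p := (yonedaFinPres C).obj Z, f := r }⟩⟩
  obtain ⟨τ₂, h₂⟩ := TraceOn.exists_extend_projectiveDimension τ₁ n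
  obtain ⟨m, hm⟩ := hf
  rw [← h₁, ← h₂ _ (projective_yonedaFinPres X)]
  apply τ₂.val_eq_zero_of_pow_eq_zero hn m
  have hpow : ∀ m : ℕ, (End.of ((yonedaFinPres C).map f) ^ m : End _)
      = (yonedaFinPres C).map (End.of f ^ m : End X) := by
    intro m
    induction m with
    | zero => exact ((yonedaFinPres C).map_id X).symm
    | succ m ih =>
      rw [pow_succ', pow_succ', End.mul_def, End.mul_def, ih, Functor.map_comp]
  rw [hpow, hm]
  apply ObjectProperty.hom_ext
  exact preadditiveYoneda.map_zero _ _

end FinPres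

namespace ExactStructure

variable {C : Type u} [Category.{v} C] [Preadditive C] (S : ExactStructure C)

/-! ### Pullbacks, pushouts and splittings of conflations -/

section Conflation

variable {S} {A B D : C} {i : A ⟶ B} {p : B ⟶ D} {w : i ≫ p = 0}

theorem exists_kernel_lift (h : S.conflation (ShortComplex.mk i p w)) {W : C} (a : W ⟶ B)
    (ha : a ≫ p = 0) : ∃ b : W ⟶ A, b ≫ i = a := by
  obtain ⟨hk⟩ := S.isKernel _ h
  exact ⟨hk.lift (KernelFork.ofι a ha), hk.fac _ WalkingParallelPair.zero⟩

theorem exists_cokernel_desc (h : S.conflation (ShortComplex.mk i p w)) {W : C} (a : B ⟶ W)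
    (ha : i ≫ a = 0) : ∃ b : D ⟶ W, p ≫ b = a := by
  obtain ⟨hc⟩ := S.isCokernel _ h
  exact ⟨hc.desc (CokernelCofork.ofπ a ha), hc.fac _ WalkingParallelPair.one⟩

theorem mono_of_conflation (h : S.conflation (ShortComplex.mk i p w)) : Mono i := by
  obtain ⟨hk⟩ := S.isKernel _ h
  exact ⟨fun a b hab => Fork.IsLimit.hom_ext hk hab⟩

theorem epi_of_conflation (h : S.conflation (ShortComplex.mk i p w)) : Epi p := by
  obtain ⟨hc⟩ := S.isCokernel _ h
  exact ⟨fun a b hab => Cofork.IsColimit.hom_ext hc hab⟩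

/-- The pullback of a deflation has the same kernel, so the kernel term can be taken to be `A`
itself. -/
theorem exists_pullback_conflation (h : S.conflation (ShortComplex.mk i p w)) {Y : C}
    (f : Y ⟶ D) : ∃ (B' : C) (i' : A ⟶ B') (p' : B' ⟶ Y) (f' : B' ⟶ B) (w' : i' ≫ p' = 0),
      S.conflation (ShortComplex.mk i' p' w') ∧ i' ≫ f' = i ∧ IsPullback f' p' p f := by
  obtain ⟨B', f', p', pb, Z, j, wj, hc⟩ := S.pullback p f ⟨A, i, w, h⟩
  have := mono_of_conflation h
  have := mono_of_conflation hc
  have hi' : i ≫ p = (0 : A ⟶ Y) ≫ f := by rw [w, zero_comp]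
  obtain ⟨a, ha⟩ := exists_kernel_lift h (j ≫ f')
    (by rw [Category.assoc, pb.w, reassoc_of% wj, zero_comp])
  obtain ⟨b, hb⟩ := exists_kernel_lift hc (pb.lift i 0 hi') (by simp)
  have hab : a ≫ b = 𝟙 Z := by
    rw [← cancel_mono j, Category.assoc, hb, Category.id_comp]
    apply pb.hom_ext <;> simp [ha, wj]
  have hba : b ≫ a = 𝟙 A := by
    rw [← cancel_mono i, Category.assoc, ha, reassoc_of% hb]
    simp
  refine ⟨B', pb.lift i 0 hi', p', f', by simp, S.of_iso ?_ hc, by simp, pb⟩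
  refine ShortComplex.isoMk ⟨a, b, hab, hba⟩ (Iso.refl _) (Iso.refl _) ?_ (by simp)
  simp [← hb, reassoc_of% hab]

theorem exists_pushout_conflation (h : S.conflation (ShortComplex.mk i p w)) {A' : C}
    (f : A ⟶ A') : ∃ (B' : C) (i' : A' ⟶ B') (p' : B' ⟶ D) (f' : B ⟶ B') (w' : i' ≫ p' = 0),
      S.conflation (ShortComplex.mk i' p' w') ∧ f' ≫ p' = p ∧ IsPushout i f f' i' := by
  obtain ⟨B', f', i', po, Z, q, wq, hc⟩ := S.pushout i f ⟨D, p, w, h⟩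
  have := epi_of_conflation h
  have := epi_of_conflation hc
  have hp' : i ≫ p = f ≫ (0 : A' ⟶ D) := by rw [w, comp_zero]
  obtain ⟨a, ha⟩ := exists_cokernel_desc h (f' ≫ q)
    (by rw [← Category.assoc, po.w, Category.assoc, wq, comp_zero])
  obtain ⟨b, hb⟩ := exists_cokernel_desc hc (po.desc p 0 hp') (by simp)
  have hab : a ≫ b = 𝟙 D := by
    rw [← cancel_epi p, reassoc_of% ha, hb]
    simp
  have hba : b ≫ a = 𝟙 Z := by
    rw [← cancel_epi q, reassoc_of% hb]
    apply po.hom_ext <;> simp [ha, wq]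
  refine ⟨B', i', po.desc p 0 hp', f', by simp, S.of_iso ?_ hc, by simp, po⟩
  refine ShortComplex.isoMk (Iso.refl _) (Iso.refl _) ⟨b, a, hba, hab⟩ (by simp) ?_
  simp [hb]

theorem exists_section_of_retraction (h : S.conflation (ShortComplex.mk i p w)) {r : B ⟶ A}
    (hr : i ≫ r = 𝟙 A) : ∃ s : D ⟶ B, s ≫ p = 𝟙 D ∧ p ≫ s = 𝟙 B - r ≫ i := by
  obtain ⟨s, hs⟩ := exists_cokernel_desc h (𝟙 B - r ≫ i) (by simp [reassoc_of% hr])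
  have := epi_of_conflation h
  refine ⟨s, ?_, hs⟩
  rw [← cancel_epi p, reassoc_of% hs]
  simp [w]

theorem exists_retraction_of_section (h : S.conflation (ShortComplex.mk i p w)) {s : D ⟶ B}
    (hs : s ≫ p = 𝟙 D) : ∃ r : B ⟶ A, i ≫ r = 𝟙 A ∧ r ≫ i = 𝟙 B - p ≫ s := by
  obtain ⟨r, hr⟩ := exists_kernel_lift h (𝟙 B - p ≫ s) (by simp [hs])
  have := mono_of_conflation h
  refine ⟨r, ?_, hr⟩
  rw [← cancel_mono i, Category.assoc, hr]
  simp [reassoc_of% w]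

end Conflation

/-! ### Split conflations and vanishing of extensions -/

section Biproduct

variable [HasBinaryBiproducts C]

theorem conflation_biprod (X Y : C) :
    S.conflation (ShortComplex.mk (biprod.inl : X ⟶ X ⊞ Y) biprod.snd (by simp)) := by
  obtain ⟨Z, q, wq, hc⟩ := S.inflation_id X
  have hq : q = 0 := by simpa using wq
  -- The cokernel `q` of the identity is zero, so the pullback of `q` along `0 : Y ⟶ Z` is the
  -- product of `X` and `Y`.
  obtain ⟨B, i, p, f, w, hc', hif, pb⟩ := exists_pullback_conflation hc (0 : Y ⟶ Z)
  let φ : B ≅ X ⊞ Y := ⟨biprod.lift f p, pb.lift biprod.fst biprod.snd (by simp [hq]),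
    by apply pb.hom_ext <;> simp, by ext <;> simp⟩
  refine S.of_iso ?_ hc'
  refine ShortComplex.isoMk (Iso.refl _) φ (Iso.refl _) ?_ ?_
  · ext <;> simp [φ, w, hif]
  · simp [φ]

theorem deflation_desc_id {X Y : C} (f : X ⟶ Y) : S.deflation (biprod.desc f (𝟙 Y)) := by
  -- A shear automorphism carrying the projection to `Y` into `(f, 1)`.
  let φ : X ⊞ Y ≅ X ⊞ Y := ⟨biprod.desc (biprod.lift (𝟙 X) (-f)) biprod.inr,
    biprod.desc (biprod.lift (𝟙 X) f) biprod.inr, by ext <;> simp, by ext <;> simp⟩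
  refine ⟨X, biprod.lift (𝟙 X) (-f), by simp, S.of_iso ?_ (S.conflation_biprod X Y)⟩
  refine ShortComplex.isoMk (Iso.refl _) φ (Iso.refl _) ?_ ?_
  · ext <;> simp [φ]
  · ext <;> simp [φ]

/-- `Ext¹(Y, X) = 0` precisely if all inflations `X ⟶ B` with cokernel `Y` have a retraction. -/
theorem ext1Vanishes_iff (Y X : C) : S.Ext1Vanishes Y X ↔
    ∀ (B : C) (i : X ⟶ B) (p : B ⟶ Y) (w : i ≫ p = 0), S.conflation (ShortComplex.mk i p w) →
      ∃ r : B ⟶ X, i ≫ r = 𝟙 X := by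
  constructor
  · intro h B i p w hc
    let e₀ : S.Extension Y X := ⟨X ⊞ Y, biprod.inl, biprod.snd, by simp, S.conflation_biprod X Y⟩
    let e : S.Extension Y X := ⟨B, i, p, w, hc⟩
    have heq : Quot.mk (Extension.Equiv (S := S)) e₀ = Quot.mk _ e := h.elim _ _
    have hgen := Quot.eqvGen_exact heq
    -- Equality in the quotient only yields a zigzag of equivalences; having a retraction is
    -- invariant along it, and the split extension has one.
    have key : ∀ a b : S.Extension Y X, Relation.EqvGen (Extension.Equiv (S := S)) a b →
        ((∃ r, a.i ≫ r = 𝟙 X) ↔ ∃ r, b.i ≫ r = 𝟙 X) := by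
      intro a b hab
      induction hab with
      | rel a b hab =>
        obtain ⟨φ, h₁, -⟩ := hab
        have h₂ : b.i ≫ φ.inv = a.i := by rw [← h₁]; simp
        exact ⟨fun ⟨r, hr⟩ => ⟨φ.inv ≫ r, by rw [reassoc_of% h₂, hr]⟩,
          fun ⟨r, hr⟩ => ⟨φ.hom ≫ r, by rw [reassoc_of% h₁, hr]⟩⟩
      | refl => exact Iff.rfl
      | symm _ _ _ ih => exact ih.symm
      | trans _ _ _ _ _ ih₁ ih₂ => exact ih₁.trans ih₂
    exact (key e₀ e hgen).1 ⟨biprod.fst, by simp [e₀]⟩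
  · intro h
    refine ⟨fun a b => ?_⟩
    induction a using Quot.ind with | _ e
    induction b using Quot.ind with | _ e'
    apply Quot.sound
    obtain ⟨r, hr⟩ := h _ _ _ _ e.conflation
    obtain ⟨r', hr'⟩ := h _ _ _ _ e'.conflation
    obtain ⟨s, hs, hs₂⟩ := exists_section_of_retraction e.conflation hr
    obtain ⟨s', hs', hs₂'⟩ := exists_section_of_retraction e'.conflation hr'
    have := epi_of_conflation e.conflation
    have := epi_of_conflation e'.conflation
    have hsr : s ≫ r = 0 := by rw [← cancel_epi e.p, reassoc_of% hs₂]; simp [hr]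
    have hsr' : s' ≫ r' = 0 := by rw [← cancel_epi e'.p, reassoc_of% hs₂']; simp [hr']
    refine ⟨⟨r ≫ e'.i + e.p ≫ s', r' ≫ e.i + e'.p ≫ s, ?_, ?_⟩, ?_, ?_⟩
    · simp [reassoc_of% hr', reassoc_of% hs', reassoc_of% e'.zero, reassoc_of% hsr', hs₂]
    · simp [reassoc_of% hr, reassoc_of% hs, reassoc_of% e.zero, reassoc_of% hsr, hs₂']
    · simp [reassoc_of% hr, reassoc_of% e.zero]
    · simp [hs', e'.zero]

variable {S}

theorem Ext1Vanishes.exists_extend {Y X : C} (h : S.Ext1Vanishes Y X) {A B : C} {i : A ⟶ B}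
    {p : B ⟶ Y} {w : i ≫ p = 0} (hc : S.conflation (ShortComplex.mk i p w)) (f : A ⟶ X) :
    ∃ g : B ⟶ X, i ≫ g = f := by
  obtain ⟨B', i', p', f', w', hc', -, po⟩ := exists_pushout_conflation hc f
  obtain ⟨r, hr⟩ := (S.ext1Vanishes_iff Y X).1 h _ _ _ _ hc'
  exact ⟨f' ≫ r, by rw [← Category.assoc, po.w, Category.assoc, hr, Category.comp_id]⟩

theorem Ext1Vanishes.exists_lift {Y X : C} (h : S.Ext1Vanishes Y X) {B D : C} {i : X ⟶ B}
    {p : B ⟶ D} {w : i ≫ p = 0} (hc : S.conflation (ShortComplex.mk i p w)) (f : Y ⟶ D) :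
    ∃ g : Y ⟶ B, g ≫ p = f := by
  obtain ⟨B', i', p', f', w', hc', -, pb⟩ := exists_pullback_conflation hc f
  obtain ⟨r, hr⟩ := (S.ext1Vanishes_iff Y X).1 h _ _ _ _ hc'
  obtain ⟨s, hs, -⟩ := exists_section_of_retraction hc' hr
  exact ⟨s ≫ f', by rw [Category.assoc, pb.w, reassoc_of% hs]⟩

end Biproduct

/-! ### Morphisms factoring through projectives -/

section FactorIdeal

variable {S}

theorem exists_lift_of_mem_factorIdeal {X Y : C} {f : X ⟶ Y} (hf : f ∈ factorIdeal S.proj X Y)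
    {D : C} (p : D ⟶ Y) (hp : S.deflation p) : ∃ g : X ⟶ D, g ≫ p = f := by
  induction hf using AddSubgroup.closure_induction with
  | mem f hf =>
    obtain ⟨Q, hQ, a, b, rfl⟩ := hf
    obtain ⟨g, hg⟩ := hQ p hp b
    exact ⟨a ≫ g, by rw [Category.assoc, hg]⟩
  | zero => exact ⟨0, zero_comp⟩
  | add f f' _ _ hf hf' =>
    obtain ⟨g, hg⟩ := hf
    obtain ⟨g', hg'⟩ := hf'
    exact ⟨g + g', by simp [hg, hg']⟩
  | neg f _ hf =>
    obtain ⟨g, hg⟩ := hf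
    exact ⟨-g, by simp [hg]⟩

theorem comp_mem_factorIdeal {X Q Y : C} (hQ : S.proj Q) (a : X ⟶ Q) (b : Q ⟶ Y) :
    a ≫ b ∈ factorIdeal S.proj X Y :=
  AddSubgroup.subset_closure ⟨Q, hQ, a, b, rfl⟩

theorem InjHull.deflation {X : C} (H : S.InjHull X) : S.deflation H.p :=
  ⟨_, _, H.zero, H.conflation⟩

theorem InjHull.comp_p_mem (hS : S.IsFrobenius) {X Y : C} (H : S.InjHull X) (a : Y ⟶ H.I) :
    a ≫ H.p ∈ factorIdeal S.proj Y H.Z :=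
  comp_mem_factorIdeal ((hS.proj_iff_inj _).2 H.inj) _ _

/-- The cosyzygy functor is faithful on the stable category. -/
theorem InjHull.Induces.mem_of_mem (hS : S.IsFrobenius) {X Y : C} {H : S.InjHull X}
    {K : S.InjHull Y} {f : X ⟶ Y} {g : H.Z ⟶ K.Z} (a : H.Induces K f g)
    (hg : g ∈ factorIdeal S.proj H.Z K.Z) : f ∈ factorIdeal S.proj X Y := by
  obtain ⟨h, h₁, h₂⟩ := a
  obtain ⟨m, hm⟩ := exists_lift_of_mem_factorIdeal hg _ K.deflation
  obtain ⟨n, hn⟩ := exists_kernel_lift K.conflation (h - H.p ≫ m) (by simp [hm, h₂])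
  have := mono_of_conflation K.conflation
  have : f = H.i ≫ n := by
    rw [← cancel_mono K.i, Category.assoc, hn, Preadditive.comp_sub, h₁, reassoc_of% H.zero,
      zero_comp, sub_zero]
  rw [this]
  exact comp_mem_factorIdeal ((hS.proj_iff_inj _).2 H.inj) _ _

/-- The cosyzygy functor is full. -/
theorem InjHull.exists_induces_of_hom (hS : S.IsFrobenius) {X Y : C} (H : S.InjHull X)
    (K : S.InjHull Y) (g : H.Z ⟶ K.Z) : ∃ f, H.Induces K f g := by
  obtain ⟨l, hl⟩ := (hS.proj_iff_inj _).2 H.inj K.p K.deflation (H.p ≫ g)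
  obtain ⟨f, hf⟩ := exists_kernel_lift K.conflation (H.i ≫ l)
    (by rw [Category.assoc, hl, reassoc_of% H.zero, zero_comp])
  exact ⟨f, l, hf.symm, hl.symm⟩

end FactorIdeal

/-! ### Cluster-tilting subcategories -/

namespace IsClusterTilting

variable {S} [HasBinaryBiproducts C] {T : ObjectProperty C}

theorem of_forall_retraction (hT : S.IsClusterTilting T) {X : C}
    (h : ∀ (Y B : C) (i : X ⟶ B) (p : B ⟶ Y) (w : i ≫ p = 0), T Y →
      S.conflation (ShortComplex.mk i p w) → ∃ r : B ⟶ X, i ≫ r = 𝟙 X) : T X :=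
  hT.maximal X fun Y hY => (S.ext1Vanishes_iff Y X).2 fun B i p w hc => h Y B i p w hY hc

theorem of_proj (hT : S.IsClusterTilting T) (hS : S.IsFrobenius) {Q : C} (hQ : S.proj Q) : T Q :=
  hT.of_forall_retraction fun Y _ i p w _ hc => (hS.proj_iff_inj Q).1 hQ i ⟨Y, p, w, hc⟩ (𝟙 Q)

theorem of_retract (hT : S.IsClusterTilting T) {X Z : C} (hZ : T Z) {s : X ⟶ Z} {r : Z ⟶ X}
    (h : s ≫ r = 𝟙 X) : T X :=
  hT.of_forall_retraction fun Y B i p w hY hc => by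
    obtain ⟨g, hg⟩ := (hT.rigid Y Z hY hZ).exists_extend hc s
    exact ⟨g ≫ r, by rw [reassoc_of% hg, h]⟩

theorem biprod (hT : S.IsClusterTilting T) {X Z : C} (hX : T X) (hZ : T Z) : T (X ⊞ Z) :=
  hT.of_forall_retraction fun Y B i p w hY hc => by
    obtain ⟨g, hg⟩ := (hT.rigid Y X hY hX).exists_extend hc biprod.fst
    obtain ⟨g', hg'⟩ := (hT.rigid Y Z hY hZ).exists_extend hc biprod.snd
    exact ⟨biprod.lift g g', by ext <;> simp [hg, hg']⟩

/-- To an approximation `f : M ⟶ X` one adds a projective deflation `q : Q ⟶ X`. That `(f, q)` on `M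
⊕ Q` is a deflation is seen by writing it as the pullback of `q` along `M ⊞ X ⟶ X` followed by the
deflation `(f, 1)`. -/
theorem exists_deflation_approx (hT : S.IsClusterTilting T) (hS : S.IsFrobenius) (X : C) :
    ∃ (M : C) (p : M ⟶ X), T M ∧ S.deflation p ∧
      ∀ N, T N → ∀ g : N ⟶ X, ∃ h : N ⟶ M, h ≫ p = g := by
  obtain ⟨M, f, hM, hf⟩ := hT.functoriallyFinite.1 X
  obtain ⟨Q, q, hQ, hq⟩ := hS.enough_proj X
  obtain ⟨B, q', d, pb, hd⟩ := S.pullback q (biprod.snd : M ⊞ X ⟶ X) hq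
  refine ⟨B, d ≫ biprod.desc f (𝟙 X), ?_, S.deflation_comp _ _ hd (S.deflation_desc_id f),
    fun N hN g => ?_⟩
  · refine hT.of_retract (hT.biprod hM (hT.of_proj hS hQ))
      (s := biprod.lift (d ≫ biprod.fst) q')
      (r := pb.lift biprod.snd (biprod.lift biprod.fst (biprod.snd ≫ q)) (by simp)) ?_
    apply pb.hom_ext
    · simp
    · ext <;> simp [pb.w]
  · obtain ⟨h, hh⟩ := hf N hN g
    exact ⟨pb.lift 0 (h ≫ biprod.inl) (by simp), by simp [hh]⟩

/-- Wakamatsu's argument: for an extension of `Y` in `T` by `K`, rigidity extends `i` to the middle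
term; the induced map `Y ⟶ X` lifts through the approximation, and subtracting the lift makes the
extension land in `K`, giving a retraction. -/
theorem kernel_of_approx (hT : S.IsClusterTilting T) {K M X : C} (hM : T M) {i : K ⟶ M}
    {p : M ⟶ X} {w : i ≫ p = 0} (hc : S.conflation (ShortComplex.mk i p w))
    (hp : ∀ N, T N → ∀ g : N ⟶ X, ∃ h : N ⟶ M, h ≫ p = g) : T K :=
  hT.of_forall_retraction fun Y B j q wq hY hcq => by
    obtain ⟨g, hg⟩ := (hT.rigid Y M hY hM).exists_extend hcq i
    obtain ⟨m, hm⟩ := exists_cokernel_desc hcq (g ≫ p) (by rw [reassoc_of% hg, w])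
    obtain ⟨h, hh⟩ := hp Y hY m
    obtain ⟨r, hr⟩ := exists_kernel_lift hc (g - q ≫ h) (by simp [hh, hm])
    have := mono_of_conflation hc
    refine ⟨r, ?_⟩
    rw [← cancel_mono i, Category.assoc, hr]
    simp [hg, reassoc_of% wq]

theorem hasApproxPresentation (hT : S.IsClusterTilting T) (hS : S.IsFrobenius) (X : C) :
    HasApproxPresentation T T X := by
  obtain ⟨M, p, hM, ⟨K, i, w, hc⟩, hp⟩ := hT.exists_deflation_approx hS X
  exact ⟨K, M, i, p, hT.kernel_of_approx hM hc hp, hM, w, fun W a ha => exists_kernel_lift hc a ha,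
    mono_of_conflation hc, hp⟩

/-- Traces on a cluster-tilting subcategory vanish on nilpotent endomorphisms. -/
theorem trace_eq_zero (hT : S.IsClusterTilting T) (hS : S.IsFrobenius)
    (hab : IsAbelian (ModCat C)) (hgl : hab.FiniteGlobalDimension) {V : Type w} [AddCommGroup V]
    (τ : TraceOn T V) {X : C} (hX : T X) (f : X ⟶ X) (hf : IsNilpotent (End.of f)) :
    τ.val X f = 0 := by
  obtain ⟨τ', h'⟩ := τ.exists_extend_approxPresentation (Q := T) fun _ h => h
  rw [← h' X hX (hT.hasApproxPresentation hS X)]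
  exact τ'.val_eq_zero_of_finiteGlobalDimension hab hgl (hT.hasApproxPresentation hS) X f hf

end IsClusterTilting

end ExactStructure

/-! ### Linear duality and the Serre pairing -/

theorem exists_functional_comp_eq {k : Type*} [Field k] {V W : Type*} [AddCommGroup V] [Module k V]
    [AddCommGroup W] [Module k W] (L : V →ₗ[k] W) (φ : V →ₗ[k] k)
    (h : LinearMap.ker L ≤ LinearMap.ker φ) : ∃ ψ : W →ₗ[k] k, ∀ x, ψ (L x) = φ x := by
  have : φ ∈ LinearMap.range L.dualMap := by
    rw [LinearMap.range_dualMap_eq_dualAnnihilator_ker, Submodule.mem_dualAnnihilator]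
    exact fun x hx => h hx
  obtain ⟨ψ, rfl⟩ := this
  exact ⟨ψ, fun x => rfl⟩

/-- The pairing of `X ⟶ Z` and `Z ⟶ X`, for `X` local, obtained from a residue map is perfect
modulo the radical. -/
theorem exists_residue_comp_eq {k : Type w} [Field k] {C : Type u} [Category.{v} C]
    [Preadditive C] [Linear k C] {X : C} (hX : IsLocalRing (End X)) {r : (X ⟶ X) →ₗ[k] k}
    (hr : r (𝟙 X) = 1) {Z : C} [Module.Finite k (Z ⟶ X)] (φ : (Z ⟶ X) →ₗ[k] k)
    (hφ : ∀ h, InRad h → φ h = 0) : ∃ g : X ⟶ Z, ∀ h, φ h = r (g ≫ h) := by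
  let B : (X ⟶ Z) →ₗ[k] Module.Dual k (Z ⟶ X) :=
    LinearMap.mk₂ k (fun g h => r (g ≫ h)) (by simp) (by simp) (by simp) (by simp)
  have : φ ∈ LinearMap.range B := by
    -- By finite dimensionality it is enough that `φ` kills every `h` with `r (g ≫ h) = 0` for all
    -- `g`. Such an `h` is radical, for otherwise some `g ≫ h` is the identity, of residue 1.
    rw [← Subspace.dualCoannihilator_dualAnnihilator_eq (W := LinearMap.range B),
      Submodule.mem_dualAnnihilator]
    intro h hh
    apply hφ
    by_contra hrad
    obtain ⟨g, hg⟩ := exists_comp_eq_id_of_not_inRad' hX hrad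
    have h0 : B g h = 0 := (Submodule.mem_dualCoannihilator _).1 hh (B g) ⟨g, rfl⟩
    have h1 : B g h = 1 := by
      change r (g ≫ h) = 1
      rw [hg, hr]
    exact one_ne_zero (h1.symm.trans h0)
  obtain ⟨g, hg⟩ := this
  exact ⟨g, fun h => (LinearMap.congr_fun hg h).symm⟩

namespace ExactStructure

variable {k : Type w} [Field k] {C : Type u} [Category.{v} C] [Preadditive C] [Linear k C]
  {S : ExactStructure C}

/-- Serre duality of the stable category for the square of the suspension, as a pairing of
morphisms in the exact category. -/
structure SerrePairing (k : Type w) [Field k] [Linear k C] (hS : S.IsFrobenius) where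
  D : ∀ X Y : C, (X ⟶ Y) →ₗ[k] (Y ⟶ (hS.hull (hS.hull X).Z).Z) →ₗ[k] k
  comp_left : ∀ {X X' Y : C} (a : X' ⟶ X) (f : X ⟶ Y) (h : Y ⟶ (hS.hull (hS.hull X').Z).Z),
    D X' Y (a ≫ f) h = D X Y f (h ≫ hS.cosyzygyMap (hS.cosyzygyMap a))
  comp_right : ∀ {X Y Y' : C} (f : X ⟶ Y) (b : Y ⟶ Y') (h : Y' ⟶ (hS.hull (hS.hull X).Z).Z),
    D X Y' (f ≫ b) h = D X Y f (b ≫ h)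
  zero_left : ∀ {X Y : C} (f : X ⟶ Y) (h), f ∈ factorIdeal S.proj _ _ → D X Y f h = 0
  zero_right : ∀ {X Y : C} (f : X ⟶ Y) (h), h ∈ factorIdeal S.proj _ _ → D X Y f h = 0
  mem_left : ∀ {X Y : C} (f : X ⟶ Y), (∀ h, D X Y f h = 0) → f ∈ factorIdeal S.proj _ _
  mem_right : ∀ {X Y : C} (h : Y ⟶ (hS.hull (hS.hull X).Z).Z), (∀ f, D X Y f h = 0) →
    h ∈ factorIdeal S.proj _ _
  exists_right : ∀ {X Y : C} (φ : (X ⟶ Y) →ₗ[k] k),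
    (∀ f ∈ factorIdeal S.proj X Y, φ f = 0) → ∃ h, ∀ f, D X Y f h = φ f

/-- The quotient functor to the stable category as a linear map on morphisms. -/
def toStableLinear (k : Type w) [Field k] [Linear k C] (S : ExactStructure C) (X Y : C) :
    (X ⟶ Y) →ₗ[k] (S.toStable.obj X ⟶ S.toStable.obj Y) where
  toFun f := S.toStable.map f
  map_add' _ _ := Functor.map_add _
  map_smul' _ _ := rfl

theorem toStableLinear_eq_zero_iff {X Y : C} (f : X ⟶ Y) :
    toStableLinear k S X Y f = 0 ↔ f ∈ factorIdeal S.proj X Y := by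
  have := S.toStable_map_eq_iff f 0
  rw [Functor.map_zero, sub_zero] at this
  exact this

theorem toStableLinear_surjective (X Y : C) : Function.Surjective (toStableLinear k S X Y) :=
  fun f => S.toStable.map_surjective f

theorem IsTwoCalabiYau.nonempty_serrePairing {hS : S.IsFrobenius} (hCY : IsTwoCalabiYau k hS)
    (hfin : ∀ X Y : C, Module.Finite k (X ⟶ Y)) : Nonempty (SerrePairing k hS) := by
  obtain ⟨e₀, he₀⟩ := hCY
  let q := fun X : C => S.toStable.obj X
  let e : ∀ X Y : C, (q X ⟶ q Y) ≃ₗ[k] Module.Dual k (q Y ⟶ q (hS.hull (hS.hull X).Z).Z) :=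
    fun X Y => e₀ (q X) (q Y)
  have he : ∀ {X X' Y Y' : C} (a : X' ⟶ X) (f : q X ⟶ q Y) (b : Y ⟶ Y')
      (h : q Y' ⟶ q (hS.hull (hS.hull X').Z).Z),
      e X' Y' (S.toStable.map a ≫ f ≫ S.toStable.map b) h = e X Y f (S.toStable.map b ≫ h ≫
        S.toStable.map (hS.cosyzygyMap (hS.cosyzygyMap a))) :=
    fun a f b h => he₀ (S.toStable.map a) f (S.toStable.map b) h
  -- `cosyzygyMap` is a choice that is functorial only in the stable category, so the identity has
  -- to be handled there.
  have hid : ∀ X : C, S.toStable.map (hS.cosyzygyMap (hS.cosyzygyMap (𝟙 X))) = 𝟙 _ := fun X =>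
    (congrArg (hS.suspension ⋙ hS.suspension).map (S.toStable.map_id X)).trans
      ((hS.suspension ⋙ hS.suspension).map_id _)
  clear_value e
  have hfin' : ∀ X Y : C, Module.Finite k (q X ⟶ q Y) := fun X Y =>
    Module.Finite.of_surjective _ (toStableLinear_surjective (k := k) (S := S) X Y)
  let D : ∀ X Y : C, (X ⟶ Y) →ₗ[k] (Y ⟶ (hS.hull (hS.hull X).Z).Z) →ₗ[k] k := fun X Y =>
    (toStableLinear k S Y (hS.hull (hS.hull X).Z).Z).dualMap ∘ₗ
      (e X Y).toLinearMap ∘ₗ toStableLinear k S X Y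
  have hD : ∀ (X Y : C) (f : X ⟶ Y) (h : Y ⟶ (hS.hull (hS.hull X).Z).Z),
    D X Y f h = e X Y (toStableLinear k S X Y f) (toStableLinear k S Y _ h) :=
    fun X Y f h => rfl
  refine ⟨⟨D, fun {X X' Y} a f h => ?_, fun {X Y Y'} f b h => ?_, fun {X Y} f h hf => ?_,
    fun {X Y} f h hh => ?_, fun {X Y} f hf => ?_, fun {X Y} h hh => ?_, fun {X Y} φ hφ => ?_⟩⟩
  · have := he a (S.toStable.map f) (𝟙 Y) (S.toStable.map h)
    rw [CategoryTheory.Functor.map_id, Category.comp_id, Category.id_comp, ← Functor.map_comp,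
      ← Functor.map_comp] at this
    exact this
  · have := he (𝟙 X) (S.toStable.map f) b (S.toStable.map h)
    rw [CategoryTheory.Functor.map_id, hid, Category.comp_id, Category.id_comp, ← Functor.map_comp,
      ← Functor.map_comp] at this
    exact this
  · rw [hD, (toStableLinear_eq_zero_iff f).2 hf, map_zero, LinearMap.zero_apply]
  · rw [hD, (toStableLinear_eq_zero_iff h).2 hh, map_zero]
  · rw [← toStableLinear_eq_zero_iff (k := k), ← (e X Y).map_eq_zero_iff]
    ext h
    obtain ⟨h, rfl⟩ := toStableLinear_surjective (k := k) (S := S) Y _ h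
    exact hf h
  · rw [← toStableLinear_eq_zero_iff (k := k)]
    have := hfin' Y (hS.hull (hS.hull X).Z).Z
    rw [← Module.forall_dual_apply_eq_zero_iff k]
    intro φ
    obtain ⟨f, hf⟩ := toStableLinear_surjective (k := k) (S := S) X Y ((e X Y).symm φ)
    have := hh f
    rw [hD, hf, LinearEquiv.apply_symm_apply] at this
    exact this
  · obtain ⟨φ', hφ'⟩ := exists_functional_comp_eq (toStableLinear k S X Y) φ fun f hf =>
      hφ f ((toStableLinear_eq_zero_iff f).1 hf)
    have := hfin' Y (hS.hull (hS.hull X).Z).Z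
    -- Finite dimensionality: the functional transported to the dual space is evaluation at a
    -- vector.
    obtain ⟨h, hh⟩ := (Module.evalEquiv k (q Y ⟶ q (hS.hull (hS.hull X).Z).Z)).surjective
      (φ' ∘ₗ (e X Y).symm.toLinearMap)
    obtain ⟨h, rfl⟩ := toStableLinear_surjective (k := k) (S := S) Y _ h
    refine ⟨h, fun f => ?_⟩
    have := LinearMap.congr_fun hh (e X Y (toStableLinear k S X Y f))
    rw [← hφ', hD]
    simpa using this

end ExactStructure

namespace ExactStructure

/-! ### The connecting morphism `X ⟶ ΣK` of a conflation -/

section Connecting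

variable {C : Type u} [Category.{v} C] [Preadditive C] {S : ExactStructure C}
  {K B X : C} {j : K ⟶ B} {p : B ⟶ X} {w : j ≫ p = 0}

theorem InjHull.exists_connecting (H : S.InjHull K)
    (h : S.conflation (ShortComplex.mk j p w)) :
    ∃ (b : B ⟶ H.I) (δ : X ⟶ H.Z), j ≫ b = H.i ∧ p ≫ δ = b ≫ H.p := by
  obtain ⟨b, hb⟩ := H.inj j ⟨X, p, w, h⟩ H.i
  obtain ⟨δ, hδ⟩ := exists_cokernel_desc h (b ≫ H.p) (by rw [reassoc_of% hb, H.zero])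
  exact ⟨b, δ, hb, hδ⟩

variable {H : S.InjHull K} {b : B ⟶ H.I} {δ : X ⟶ H.Z}

/-- Exactness of the long sequence at `Hom(Z, X)`, with a lift in the exact category and not just a
stable one: if `f ≫ δ` is stably zero, it lifts to `H.I`, and this splits the pullback of the
conflation along `f`. -/
theorem InjHull.exists_lift_of_comp_connecting_mem (h : S.conflation (ShortComplex.mk j p w))
    (hb : j ≫ b = H.i) (hδ : p ≫ δ = b ≫ H.p) {Z : C} (f : Z ⟶ X)
    (hf : f ≫ δ ∈ factorIdeal S.proj Z H.Z) : ∃ g : Z ⟶ B, g ≫ p = f := by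
  obtain ⟨l, hl⟩ := exists_lift_of_mem_factorIdeal hf _ H.deflation
  obtain ⟨Z', κ, z, f', w', hc', hκ, pb⟩ := exists_pullback_conflation h f
  obtain ⟨m, hm⟩ := exists_kernel_lift H.conflation (f' ≫ b - z ≫ l) (by
    rw [Preadditive.sub_comp, Category.assoc, Category.assoc, hl, ← hδ, ← Category.assoc, pb.w,
      Category.assoc, sub_self])
  have := mono_of_conflation H.conflation
  have := epi_of_conflation hc'
  have hm' : κ ≫ m = 𝟙 K := by
    rw [← cancel_mono H.i, Category.assoc, hm, Preadditive.comp_sub, reassoc_of% hκ,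
      reassoc_of% w', hb, zero_comp, sub_zero, Category.id_comp]
  obtain ⟨g, hg⟩ := exists_cokernel_desc hc' (f' - m ≫ j)
    (by rw [Preadditive.comp_sub, hκ, reassoc_of% hm', sub_self])
  refine ⟨g, ?_⟩
  rw [← cancel_epi z, reassoc_of% hg, Preadditive.sub_comp, Category.assoc, w, comp_zero, sub_zero,
    pb.w]

theorem InjHull.comp_connecting_mem (hS : S.IsFrobenius) (hδ : p ≫ δ = b ≫ H.p) {Z : C}
    (g : Z ⟶ B) : g ≫ p ≫ δ ∈ factorIdeal S.proj Z H.Z := by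
  rw [hδ, ← Category.assoc]
  exact H.comp_p_mem hS _

/-- Exactness at stable `Hom(Z, ΣK)`: when `Ext¹(Z, B) = 0`, composition with `δ` reaches every
class. The extension of `Z` by `K` given by `y` becomes split after pushing out to `B`. -/
theorem InjHull.exists_sub_comp_connecting_mem [HasBinaryBiproducts C] (hS : S.IsFrobenius)
    (w : j ≫ p = 0) (hb : j ≫ b = H.i) (hδ : p ≫ δ = b ≫ H.p) {Z : C}
    (hZ : S.Ext1Vanishes Z B) (y : Z ⟶ H.Z) :
    ∃ f : Z ⟶ X, y - f ≫ δ ∈ factorIdeal S.proj Z H.Z := by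
  obtain ⟨D, κ, q, d, wD, hD, hκ, pb⟩ := exists_pullback_conflation H.conflation y
  obtain ⟨n, hn⟩ := hZ.exists_extend hD j
  obtain ⟨f, hf⟩ := exists_cokernel_desc hD (n ≫ p) (by rw [reassoc_of% hn, w])
  obtain ⟨m, hm⟩ := exists_cokernel_desc hD (d - n ≫ b)
    (by rw [Preadditive.comp_sub, hκ, reassoc_of% hn, hb, sub_self])
  have := epi_of_conflation hD
  have e : y - f ≫ δ = m ≫ H.p := by
    rw [← cancel_epi q, reassoc_of% hm, Preadditive.comp_sub, reassoc_of% hf, hδ,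
      Preadditive.sub_comp, Category.assoc, pb.w]
  exact ⟨f, e ▸ H.comp_p_mem hS m⟩

end Connecting

/-! ### Almost split maps in the cluster-tilting subcategory -/

section Local

variable {k : Type w} [Field k] {C : Type u} [Category.{v} C] [Preadditive C] [Linear k C] {S : ExactStructure C} {T : ObjectProperty C}

/-- An isomorphism in the ideal would put the identity there, so `X` would be a retract of a
projective. -/
theorem inRad_of_mem_factorIdeal (hS : S.IsFrobenius) {X : C} (hX : IsLocalRing (End X))
    (hXp : ¬ S.proj X) {f : X ⟶ X} (hf : f ∈ factorIdeal S.proj X X) : InRad f := by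
  rw [inRad_iff_not_isIso hX]
  intro hiso
  have h1 : 𝟙 X ∈ factorIdeal S.proj X X := by
    have := factorIdeal_comp_right S.proj hf (inv f)
    rwa [IsIso.hom_inv_id] at this
  obtain ⟨Q, q, hQ, hq⟩ := hS.enough_proj X
  obtain ⟨s, hs⟩ := exists_lift_of_mem_factorIdeal h1 q hq
  refine hXp fun A B p hp f => ?_
  obtain ⟨g, hg⟩ := hQ p hp (q ≫ f)
  exact ⟨s ≫ g, by rw [Category.assoc, hg, reassoc_of% hs]⟩

variable [HasBinaryBiproducts C]

/-- A right almost split morphism in a cluster-tilting subcategory, ending at a local object that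
is not projective, can be chosen to be a deflation. -/
theorem IsClusterTilting.exists_rightAlmostSplit (hT : S.IsClusterTilting T) {hS : S.IsFrobenius}
    (P : SerrePairing k hS) {X : C} (hX : IsLocalRing (End X)) (hXp : ¬ S.proj X)
    {r : (X ⟶ X) →ₗ[k] k} (hr : r (𝟙 X) = 1) (hr₀ : ∀ f, InRad f → r f = 0) :
    ∃ (K B : C) (j : K ⟶ B) (p : B ⟶ X) (w : j ≫ p = 0),
      S.conflation (ShortComplex.mk j p w) ∧ T B ∧ InRad p ∧
      ∀ Z, T Z → ∀ h : Z ⟶ X, InRad h → ∃ g : Z ⟶ B, g ≫ p = h := by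
  -- The class `η : X ⟶ Σ²X` dual to the residue map. Pulling back `ΣX ⟶ I ⟶ Σ²X` along it gives an
  -- almost split conflation `ΣX ⟶ A ⟶ X` in the whole category; a `T`-approximation of `A` then
  -- gives `B`.
  obtain ⟨η, hη⟩ := P.exists_right r fun f hf => hr₀ f (inRad_of_mem_factorIdeal hS hX hXp hf)
  let H := hS.hull (hS.hull X).Z
  obtain ⟨A, i, a, f, wA, hA, -, pb⟩ := exists_pullback_conflation H.conflation η
  have hrad : ∀ Z (h : Z ⟶ X), InRad h → ∃ g : Z ⟶ A, g ≫ a = h := by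
    intro Z h hh
    have hmem : h ≫ η ∈ factorIdeal S.proj _ _ := by
      refine P.mem_right _ fun s => ?_
      rw [← P.comp_right, hη]
      exact hr₀ _ (hh.comp_left s)
    obtain ⟨l, hl⟩ := exists_lift_of_mem_factorIdeal hmem _ H.deflation
    exact ⟨pb.lift l h hl, by simp⟩
  have hsplit : ∀ s : X ⟶ A, s ≫ a ≠ 𝟙 X := by
    intro s hs
    have hmem : η ∈ factorIdeal S.proj _ _ := by
      have : η = (s ≫ f) ≫ H.p := by rw [Category.assoc, pb.w, reassoc_of% hs]
      rw [this]
      exact H.comp_p_mem hS _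
    have := hη (𝟙 X)
    rw [P.zero_right _ _ hmem, hr] at this
    exact zero_ne_one this
  obtain ⟨B, q, hB, hq, hq'⟩ := hT.exists_deflation_approx hS A
  obtain ⟨K, j, w, hc⟩ := S.deflation_comp q a hq ⟨_, i, wA, hA⟩
  refine ⟨K, B, j, q ≫ a, w, hc, hB, ?_, fun Z hZ h hh => ?_⟩
  · by_contra hp
    obtain ⟨g, hg⟩ := exists_comp_eq_id_of_not_inRad' hX hp
    exact hsplit (g ≫ q) (by rw [Category.assoc, hg])
  · obtain ⟨g, hg⟩ := hrad Z h hh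
    obtain ⟨g', hg'⟩ := hq' Z hZ g
    exact ⟨g', by rw [reassoc_of% hg', hg]⟩

/-- The kernel `K` of a right almost split deflation ending at `X` is the cokernel of a left almost
split inflation starting at `X`. -/
theorem IsClusterTilting.exists_leftAlmostSplit (hT : S.IsClusterTilting T) {hS : S.IsFrobenius}
    (P : SerrePairing k hS) (hfin : ∀ X Y : C, Module.Finite k (X ⟶ Y)) {X : C} (hTX : T X)
    (hX : IsLocalRing (End X)) {r : (X ⟶ X) →ₗ[k] k} (hr : r (𝟙 X) = 1)
    (hr₀ : ∀ f, InRad f → r f = 0) {K B : C} {j : K ⟶ B} {p : B ⟶ X} {w : j ≫ p = 0}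
    (hc : S.conflation (ShortComplex.mk j p w)) (hTB : T B) (hp : InRad p)
    (hp' : ∀ Z, T Z → ∀ h : Z ⟶ X, InRad h → ∃ g : Z ⟶ B, g ≫ p = h) :
    ∃ (B₁ : C) (i : X ⟶ B₁) (t : B₁ ⟶ K) (w₁ : i ≫ t = 0),
      S.conflation (ShortComplex.mk i t w₁) ∧ T B₁ ∧ (∀ d : B₁ ⟶ X, i ≫ d ≠ 𝟙 X) ∧
      ∀ Z, T Z → ∀ g : X ⟶ Z, InRad g → ∃ g' : B₁ ⟶ Z, i ≫ g' = g := by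
  let H := hS.hull K
  obtain ⟨b, δ, hb, hδ⟩ := H.exists_connecting hc
  have hmem : ∀ {Z : C} (g : Z ⟶ B), (g ≫ p) ≫ δ ∈ factorIdeal S.proj Z H.Z := fun g => by
    rw [Category.assoc]
    exact InjHull.comp_connecting_mem hS hδ g
  -- `f ≫ δ ↦ r f` is well defined: if `f ≫ δ` is stably zero, then `f` factors through the radical
  -- map `p`, so `r f = 0`.
  obtain ⟨θ, hθ⟩ := exists_functional_comp_eq
    (toStableLinear k S X H.Z ∘ₗ Linear.rightComp k X δ) r (by
      intro f hf
      obtain ⟨g, rfl⟩ := InjHull.exists_lift_of_comp_connecting_mem hc hb hδ f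
        ((toStableLinear_eq_zero_iff (k := k) (S := S) (f ≫ δ)).1 hf)
      exact hr₀ _ (hp.comp_left g))
  obtain ⟨ε, hε⟩ := P.exists_right (θ ∘ₗ toStableLinear k S X H.Z) fun f hf => by
    rw [LinearMap.comp_apply, (toStableLinear_eq_zero_iff f).2 hf, map_zero]
  have hεδ : ∀ f : X ⟶ X, P.D X H.Z (f ≫ δ) ε = r f := fun f => by
    rw [hε]
    exact hθ f
  -- The Serre dual `ε : ΣK ⟶ Σ²X` of the functional `θ` desuspends to `ε' : K ⟶ ΣX`, which
  -- classifies the wanted conflation `X ⟶ B₁ ⟶ K`.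
  obtain ⟨ε', hε'⟩ := H.exists_induces_of_hom hS (hS.hull (hS.hull X).Z) ε
  let HX := hS.hull X
  obtain ⟨B₁, i, t, b₁, w₁, hc₁, hi, pb⟩ := exists_pullback_conflation HX.conflation ε'
  have hext : ∀ Z, T Z → ∀ y : Z ⟶ H.Z, ∃ f : Z ⟶ X, y - f ≫ δ ∈ factorIdeal S.proj Z H.Z :=
    fun Z hZ y => InjHull.exists_sub_comp_connecting_mem hS w hb hδ (hT.rigid Z B hZ hTB) y
  have hpair : ∀ {Z : C} (g : X ⟶ Z) (h : Z ⟶ X), P.D Z H.Z (h ≫ δ)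
      (ε ≫ hS.cosyzygyMap (hS.cosyzygyMap g)) = r (g ≫ h) := fun g h => by
    rw [← P.comp_left, ← Category.assoc, hεδ]
  -- For `Z` in `T` the pairing need only be tested on maps `f ≫ δ`, since these exhaust stable
  -- `Hom(Z, ΣK)`.
  have hzero : ∀ {Z : C}, T Z → ∀ h : H.Z ⟶ (hS.hull (hS.hull Z).Z).Z,
      (∀ f : Z ⟶ X, P.D Z H.Z (f ≫ δ) h = 0) → h ∈ factorIdeal S.proj _ _ := by
    intro Z hZ h hh
    refine P.mem_right h fun y => ?_
    obtain ⟨f, hf⟩ := hext Z hZ y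
    have := P.zero_left _ h hf
    rwa [map_sub, LinearMap.sub_apply, hh, sub_zero] at this
  have hind : ∀ {Z : C} (g : X ⟶ Z), H.Induces (hS.hull (hS.hull Z).Z)
      (ε' ≫ hS.cosyzygyMap g) (ε ≫ hS.cosyzygyMap (hS.cosyzygyMap g)) := fun g =>
    hε'.comp (hS.cosyzygyMap_induces _)
  have hpush : ∀ {Z : C} (g : X ⟶ Z), ∃ hg : HX.I ⟶ (hS.hull Z).I, HX.i ≫ hg = g ≫ (hS.hull Z).i ∧
      t ≫ ε' ≫ hS.cosyzygyMap g = (b₁ ≫ hg) ≫ (hS.hull Z).p := fun {Z} g => by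
    obtain ⟨hg, h₁, h₂⟩ := hS.cosyzygyMap_induces g
    refine ⟨hg, h₁, ?_⟩
    rw [← Category.assoc, ← pb.w, Category.assoc, h₂, Category.assoc]
  refine ⟨B₁, i, t, w₁, hc₁, ?_, fun d hd => ?_, fun Z hZ g hg => ?_⟩
  -- Membership of `B₁` in `T`: first stable `Hom(B₁, ΣZ) = 0` for `Z` in `T`; the 2-Calabi–Yau
  -- duality then turns this into `Ext¹(Z, B₁) = 0`.
  · have hB₁ : ∀ Z, T Z → ∀ y : B₁ ⟶ (hS.hull Z).Z, y ∈ factorIdeal S.proj _ _ := by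
      intro Z hZ y
      let HZ := hS.hull Z
      obtain ⟨l, hl⟩ := (hT.rigid X Z hTX hZ).exists_lift HZ.conflation (i ≫ y)
      obtain ⟨l', hl'⟩ := HZ.inj i ⟨_, _, _, hc₁⟩ l
      obtain ⟨y', hy'⟩ := exists_cokernel_desc hc₁ (y - l' ≫ HZ.p)
        (by rw [Preadditive.comp_sub, reassoc_of% hl', hl, sub_self])
      -- Modulo injectives `y` comes from `y' : K ⟶ ΣZ`. Its pairing with the maps `h ≫ δ` kills
      -- radical `h`, so it is `r (g ≫ h)` for some `g`. Hence `y'` agrees stably with `ε' ≫ Σg`,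
      -- which dies on `B₁`.
      obtain ⟨g, hg⟩ := exists_residue_comp_eq hX hr (Z := Z)
        ((P.D Z H.Z).flip (hS.cosyzygyMap y') ∘ₗ Linear.rightComp k Z δ) (by
          intro h hh
          obtain ⟨g, rfl⟩ := hp' Z hZ h hh
          exact P.zero_left _ _ (hmem g))
      have h₁ : hS.cosyzygyMap y' - ε ≫ hS.cosyzygyMap (hS.cosyzygyMap g) ∈
          factorIdeal S.proj _ _ := by
        refine hzero hZ _ fun f => ?_
        rw [map_sub, hpair, ← hg]
        exact sub_self _
      have h₂ : y' - ε' ≫ hS.cosyzygyMap g ∈ factorIdeal S.proj _ _ :=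
        ((hS.cosyzygyMap_induces y').sub (hind g)).mem_of_mem hS h₁
      obtain ⟨hg', -, h₃⟩ := hpush g
      have e : y = l' ≫ HZ.p + (t ≫ (y' - ε' ≫ hS.cosyzygyMap g)
          + (b₁ ≫ hg') ≫ (hS.hull Z).p) := by
        rw [← h₃, Preadditive.comp_sub, sub_add_cancel, hy']
        abel
      rw [e]
      exact add_mem (HZ.comp_p_mem hS _)
        (add_mem (factorIdeal_comp_left _ _ h₂) ((hS.hull Z).comp_p_mem hS _))
    refine hT.of_forall_retraction fun Y D i₁ p₁ wD hY hD => ?_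
    let H₁ := hS.hull B₁
    obtain ⟨b', δ', hb', hδ'⟩ := H₁.exists_connecting hD
    -- Every `ΣB₁ ⟶ Σ²Y` is the suspension of a map `B₁ ⟶ ΣY`, which is stably zero; nondegeneracy
    -- gives `δ' = 0` stably, so the extension splits.
    have hmem' : δ' ∈ factorIdeal S.proj _ _ := by
      refine P.mem_left δ' fun h => P.zero_right _ _ ?_
      obtain ⟨h', hh'⟩ := H₁.exists_induces_of_hom hS (hS.hull (hS.hull Y).Z) h
      exact hh'.mem hS (hB₁ Y hY h')
    obtain ⟨s, hs⟩ := InjHull.exists_lift_of_comp_connecting_mem hD hb' hδ' (𝟙 Y)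
      (by rwa [Category.id_comp])
    obtain ⟨ρ, hρ, -⟩ := exists_retraction_of_section hD hs
    exact ⟨ρ, hρ⟩
  -- A retraction of `i` would make `ε'`, hence `ε`, stably zero, although `ε` pairs with `δ` to `r
  -- (𝟙 X) = 1`.
  · obtain ⟨m, hm⟩ := exists_cokernel_desc hc₁ (b₁ - d ≫ HX.i)
      (by rw [Preadditive.comp_sub, hi, reassoc_of% hd, sub_self])
    have := epi_of_conflation hc₁
    have e : ε' = m ≫ HX.p := by
      rw [← cancel_epi t, reassoc_of% hm, Preadditive.sub_comp, Category.assoc, HX.zero, comp_zero,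
        sub_zero, pb.w]
    have h₁ : ε ∈ factorIdeal S.proj _ _ :=
      hε'.mem hS (e ▸ HX.comp_p_mem hS m)
    have := hεδ (𝟙 X)
    rw [P.zero_right _ _ h₁, hr] at this
    exact zero_ne_one this
  -- For radical `g`, `r (g ≫ h) = 0` for all `h`, so `ε' ≫ Σg` is stably zero: the pushout of the
  -- conflation along `g` splits.
  · have h₁ : ε' ≫ hS.cosyzygyMap g ∈ factorIdeal S.proj _ _ :=
      (hind g).mem_of_mem hS (hzero hZ _ fun f => by rw [hpair]; exact hr₀ _ (hg.comp_right f))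
    obtain ⟨l, hl⟩ := exists_lift_of_mem_factorIdeal h₁ _ (hS.hull Z).deflation
    obtain ⟨hg', h₂, h₃⟩ := hpush g
    obtain ⟨n, hn⟩ := exists_kernel_lift (hS.hull Z).conflation (b₁ ≫ hg' - t ≫ l)
      (by rw [Preadditive.sub_comp, ← h₃, Category.assoc, hl, sub_self])
    have := mono_of_conflation (hS.hull Z).conflation
    refine ⟨n, ?_⟩
    rw [← cancel_mono (hS.hull Z).i, Category.assoc, hn, Preadditive.comp_sub, reassoc_of% hi,
      reassoc_of% w₁, zero_comp, sub_zero, h₂]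

/-- Given a dinatural pairing of radical morphisms into and out of `X`, there is a functional on the
endomorphisms of `X` whose value at composites of radical morphisms is given by the pairing. The
point is that there are no relations from `X` to itself. -/
theorem IsClusterTilting.exists_functional [IsAlgClosed k] (hT : S.IsClusterTilting T) {hS : S.IsFrobenius}
    (P : SerrePairing k hS) (hfin : ∀ X Y : C, Module.Finite k (X ⟶ Y)) {X : C} (hTX : T X)
    (hX : IsLocalRing (End X)) (hXp : ¬ S.proj X)
    (hloop : ∀ f : X ⟶ X, InRad f → RadSqThrough T f)
    (F : ∀ Z : C, (X ⟶ Z) → (Z ⟶ X) → k)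
    (hadd : ∀ (Z : C) (u u' : X ⟶ Z) (v : Z ⟶ X), T Z → InRad u → InRad u' → InRad v →
      F Z (u + u') v = F Z u v + F Z u' v)
    (hsmul : ∀ (Z : C) (c : k) (u : X ⟶ Z) (v : Z ⟶ X), T Z → InRad u → InRad v →
      F Z (c • u) v = c * F Z u v)
    (hcomp : ∀ (Z Z' : C) (u : X ⟶ Z) (z : Z ⟶ Z') (v : Z' ⟶ X), T Z → T Z' → InRad u →
      InRad v → F Z' (u ≫ z) v = F Z u (z ≫ v))
    (hzero : ∀ (Z : C) (u : X ⟶ Z), T Z → InRad u → F Z u 0 = 0) :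
    ∃ ψ : (X ⟶ X) →ₗ[k] k, ∀ Z, T Z → ∀ (u : X ⟶ Z) (v : Z ⟶ X), InRad u → InRad v →
      ψ (u ≫ v) = F Z u v := by
  obtain ⟨r, hr, hr'⟩ := exists_residue k hX
  have hr₀ : ∀ f, InRad f → r f = 0 := fun f => (hr' f).2
  obtain ⟨K, B, j, p, w, hc, hTB, hp, hp'⟩ := hT.exists_rightAlmostSplit P hX hXp hr hr₀
  obtain ⟨B₁, i, t, w₁, hc₁, hTB₁, hsplit, hi⟩ :=
    hT.exists_leftAlmostSplit P hfin hTX hX hr hr₀ hc hTB hp hp'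
  -- A relation `a ≫ p = 0` passes through `K`, and by rigidity lifts to `c' : X ⟶ B₁`. If `c'` is
  -- radical, dinaturality moves `t ≫ j` to the other side, where `t ≫ j ≫ p = 0`.
  have hker : ∀ a : X ⟶ B, InRad a → a ≫ p = 0 → F B a p = 0 := by
    intro a ha hap
    obtain ⟨c, hc'⟩ := exists_kernel_lift hc a hap
    obtain ⟨c', hcc'⟩ := (hT.rigid X X hTX hTX).exists_lift hc₁ c
    by_cases hrad : InRad c'
    · have e : a = c' ≫ t ≫ j := by rw [reassoc_of% hcc', hc']
      rw [e, hcomp _ _ _ _ _ hTB₁ hTB hrad hp, Category.assoc, w, comp_zero, hzero _ _ hTB₁ hrad]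
    -- Otherwise `c' ≫ d = 𝟙`. The radical endomorphism `i ≫ d` is in rad² by the absence of loops,
    -- so `d = g' ≫ h + t ≫ m` with `h` radical. Extending `m` along `j` to `n` gives `𝟙 = c' ≫ g' ≫
    -- h + a ≫ n`, which is radical: absurd.
    · exfalso
      obtain ⟨d, hd⟩ := exists_comp_eq_id_of_not_inRad hX hrad
      have hid : InRad (i ≫ d) := by
        refine inRad_of_forall_not_isIso hX fun g hg => hsplit (d ≫ g ≫ inv ((i ≫ d) ≫ g)) ?_
        have := IsIso.hom_inv_id ((i ≫ d) ≫ g)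
        simpa only [Category.assoc] using this
      obtain ⟨Z, g, h, hTZ, hg, hh, e⟩ := hloop _ hid
      obtain ⟨g', rfl⟩ := hi Z hTZ g hg
      obtain ⟨m, hm⟩ := exists_cokernel_desc hc₁ (d - g' ≫ h)
        (by rw [Preadditive.comp_sub, e, Category.assoc, sub_self])
      obtain ⟨n, hn⟩ := (hT.rigid X X hTX hTX).exists_extend hc m
      have e₁ : 𝟙 X = c' ≫ g' ≫ h + a ≫ n := by
        have : d = g' ≫ h + t ≫ m := by rw [hm]; abel
        rw [← hd, this, Preadditive.comp_add, reassoc_of% hcc', ← hn, reassoc_of% hc']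
      have h1 : InRad (𝟙 X) := by
        rw [e₁, ← Category.assoc]
        exact (hh.comp_left _).add (ha.comp_right _)
      exact h1.not_isIso (id_ne_zero_of_isLocalRing hX) inferInstance
  let ℓ : radSubmodule k X B →ₗ[k] k :=
    { toFun := fun a => F B a.1 p
      map_add' := fun a a' => hadd _ _ _ _ hTB a.2 a'.2 hp
      map_smul' := fun c a => hsmul _ _ _ _ hTB a.2 hp }
  -- Every radical map from `T` to `X` factors through `p`, so prescribing `ψ (a ≫ p)` for radical
  -- `a` determines `ψ` on all composites of radical maps.
  obtain ⟨ψ, hψ⟩ := exists_functional_comp_eq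
    (Linear.rightComp k X p ∘ₗ (radSubmodule k X B).subtype) ℓ fun a ha => hker a.1 a.2 ha
  refine ⟨ψ, fun Z hZ u v hu hv => ?_⟩
  obtain ⟨v', rfl⟩ := hp' Z hZ v hv
  have := hψ ⟨u ≫ v', hu.comp_right v'⟩
  rw [← hcomp _ _ _ _ _ hZ hTB hu hp, ← Category.assoc]
  exact this

end Local

end ExactStructure

/-! ### Traces that detect loops and 2-cycles -/

namespace ExactStructure

variable {k : Type w} [Field k] {C : Type u} [Category.{v} C] [Preadditive C] [Linear k C]
  {S : ExactStructure C} {T : ObjectProperty C}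

/-- A functional on the endomorphisms of a local object that vanishes on products of radical
endomorphisms is a trace. -/
theorem map_comp_comm_of_isLocalRing [IsAlgClosed k] (hfin : ∀ X Y : C, Module.Finite k (X ⟶ Y))
    {X : C} (hX : IsLocalRing (End X)) (ψ : (X ⟶ X) →ₗ[k] k)
    (hψ : ∀ f g : X ⟶ X, InRad f → InRad g → ψ (f ≫ g) = 0) (f g : X ⟶ X) :
    ψ (f ≫ g) = ψ (g ≫ f) := by
  obtain ⟨a, ha⟩ := exists_sub_smul_id_inRad (k := k) hX f
  obtain ⟨b, hb⟩ := exists_sub_smul_id_inRad (k := k) hX g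
  have h₁ := hψ _ _ ha hb
  have h₂ := hψ _ _ hb ha
  have e : f ≫ g - g ≫ f = (f - a • 𝟙 X) ≫ (g - b • 𝟙 X) - (g - b • 𝟙 X) ≫ (f - a • 𝟙 X) := by
    simp only [Preadditive.sub_comp, Preadditive.comp_sub, Linear.smul_comp, Linear.comp_smul,
      Category.id_comp, Category.comp_id, smul_smul, smul_sub, mul_comm]
    abel
  rw [← sub_eq_zero, ← map_sub, e, map_sub, h₁, h₂, sub_zero]

/-- Continuation by zero: by Krull–Schmidt an object of `T` is a sum of objects of `O` and of local
objects isomorphic to none of them. Maps between the two kinds are radical, so only `hzero` is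
needed for mixed composites. -/
theorem IsClusterTilting.exists_trace {V : Type w} [AddCommGroup V] [HasFiniteBiproducts C] [HasBinaryBiproducts C]
    (hT : S.IsClusterTilting T) (hKS : IsKrullSchmidt C) (O : ObjectProperty C)
    (hO : ∀ X, O X → IsLocalRing (End X)) (φ : ∀ Z : C, (Z ⟶ Z) →+ V)
    (hφ : ∀ Z, ¬ O Z → φ Z = 0)
    (hcomm : ∀ X Y, O X → O Y → ∀ (f : X ⟶ Y) (g : Y ⟶ X), φ X (f ≫ g) = φ Y (g ≫ f))
    (hzero : ∀ X Z, O X → T Z → (∀ W, O W → ∀ f : W ⟶ Z, InRad f) →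
      (∀ W, O W → ∀ f : Z ⟶ W, InRad f) → ∀ (f : X ⟶ Z) (g : Z ⟶ X), φ X (f ≫ g) = 0) :
    ∃ τ : TraceOn T V, ∀ X, O X → ∀ f, τ.val X f = φ X f := by
  let D : ObjectProperty C := fun Z => O Z ∨ (¬ O Z ∧ T Z ∧ (∀ W, O W → ∀ f : W ⟶ Z, InRad f) ∧
    ∀ W, O W → ∀ f : Z ⟶ W, InRad f)
  let τ : TraceOn D V := ⟨φ, by
    rintro X Y (hX | ⟨hX, hTX, h₁, h₂⟩) (hY | ⟨hY, hTY, h₁', h₂'⟩) f g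
    · exact hcomm X Y hX hY f g
    · rw [hzero X Y hX hTY h₁' h₂', hφ Y hY]; rfl
    · rw [hzero Y X hY hTX h₁ h₂, hφ X hX]; rfl
    · rw [hφ X hX, hφ Y hY]; rfl⟩
  obtain ⟨τ', hτ'⟩ := τ.exists_extend_sumRetract
  have hsum : ∀ Z, T Z → IsSumRetract D Z := by
    intro Z hZ
    obtain ⟨n, Y, hY, ⟨e⟩⟩ := hKS Z
    have hTY : ∀ l, T (Y l) := fun l => hT.of_retract hZ
      (s := biproduct.ι Y l ≫ e.inv) (r := e.hom ≫ biproduct.π Y l) (by simp)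
    -- `O` need not be closed under isomorphism, so a summand isomorphic to an object of `O` is
    -- replaced by that object.
    have key : ∀ l, ∃ W, D W ∧ Nonempty (Y l ≅ W) := by
      intro l
      by_cases h : ∃ W, O W ∧ Nonempty (Y l ≅ W)
      · obtain ⟨W, hW, hi⟩ := h
        exact ⟨W, Or.inl hW, hi⟩
      · push Not at h
        refine ⟨Y l, Or.inr ⟨fun h' => (h _ h').elim (Iso.refl _), hTY l, fun W hW => ?_,
          fun W hW => ?_⟩, ⟨Iso.refl _⟩⟩
        · exact inRad_of_isEmpty_iso (hO W hW) (hY l) ⟨fun e => (h W hW).false e.symm⟩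
        · exact inRad_of_isEmpty_iso (hY l) (hO W hW) (h W hW)
    choose W hW i using key
    refine ⟨n, W, fun l => (i l).some.inv ≫ biproduct.ι Y l ≫ e.inv,
      fun l => e.hom ≫ biproduct.π Y l ≫ (i l).some.hom, hW, ?_⟩
    simp only [Category.assoc, Iso.hom_inv_id_assoc]
    rw [← Preadditive.comp_sum]
    simp only [← Category.assoc]
    rw [← Preadditive.sum_comp]
    simp [biproduct.total]
  exact ⟨⟨τ'.val, fun X Y hX hY => τ'.comm X Y (hsum X hX) (hsum Y hY)⟩,
    fun X hX f => hτ' X (Or.inl hX) f⟩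

variable [IsAlgClosed k] [HasFiniteBiproducts C]

/-- The quiver of a cluster-tilting subcategory has no loops. -/
theorem IsClusterTilting.radSqThrough_of_inRad (hT : S.IsClusterTilting T) (hS : S.IsFrobenius)
    (hab : IsAbelian (ModCat C)) (hgl : hab.FiniteGlobalDimension)
    (hKS : IsKrullSchmidt C) (hfin : ∀ X Y : C, Module.Finite k (X ⟶ Y)) {X : C} (hTX : T X)
    (hX : IsLocalRing (End X)) (f : X ⟶ X) (hf : InRad f) : RadSqThrough T f := by
  classical
  have := hasBinaryBiproducts_of_finite_biproducts C
  by_contra hf'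
  obtain ⟨ψ, hψf, hψ⟩ := Submodule.exists_le_ker_of_notMem
    (p := radSqSubmodule k T (fun _ _ h h' => hT.biprod h h') hTX X X) hf'
  have hψ' : ∀ g, RadSqThrough T g → ψ g = 0 := fun g hg => hψ hg
  have hupd := Function.update_self (β := fun Z : C => (Z ⟶ Z) →+ k) X ψ.toAddMonoidHom 0
  obtain ⟨τ, hτ⟩ := hT.exists_trace (V := k) hKS (fun Z => Z = X) (by rintro _ rfl; exact hX)
    (Function.update (β := fun Z : C => (Z ⟶ Z) →+ k) 0 X ψ.toAddMonoidHom)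
    (fun Z hZ => Function.update_of_ne hZ _ _)
    (by
      rintro _ _ rfl rfl f g
      rw [hupd]
      exact map_comp_comm_of_isLocalRing hfin hX ψ
        (fun f g hf hg => hψ' _ ⟨_, f, g, hTX, hf, hg, rfl⟩) f g)
    (by
      rintro _ Z rfl hZ h₁ h₂ f g
      rw [hupd]
      exact hψ' _ ⟨Z, f, g, hZ, h₁ _ rfl f, h₂ _ rfl g, rfl⟩)
  have h := hτ X rfl f
  rw [hT.trace_eq_zero hS hab hgl τ hTX f (hf.isNilpotent (k := k)), hupd] at h
  exact hψf h.symm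

/-- For functionals on the arrows `X ⟶ Y` and `Y ⟶ X`, the corresponding functional on paths of
length two from `X` to itself. -/
theorem IsClusterTilting.exists_functional_on_paths (hT : S.IsClusterTilting T) {hS : S.IsFrobenius}
    (P : SerrePairing k hS) (hfin : ∀ X Y : C, Module.Finite k (X ⟶ Y)) {X Y : C} (hTX : T X)
    (hTY : T Y) (hX : IsLocalRing (End X)) (hY : IsLocalRing (End Y)) (hXp : ¬ S.proj X)
    (hloop : ∀ f : X ⟶ X, InRad f → RadSqThrough T f) (hXY : IsEmpty (X ≅ Y))
    (α : (X ⟶ Y) →ₗ[k] k) (hα : ∀ f, RadSqThrough T f → α f = 0)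
    (β : (Y ⟶ X) →ₗ[k] k) (hβ : ∀ f, RadSqThrough T f → β f = 0) :
    ∃ ψ : (X ⟶ X) →ₗ[k] k, (∀ u v, ψ (u ≫ v) = α u * β v) ∧
      ∀ Z, T Z → (∀ z : Z ⟶ Y, InRad z) → ∀ (u : X ⟶ Z) (v : Z ⟶ X), InRad u → InRad v →
        ψ (u ≫ v) = 0 := by
  have := hasBinaryBiproducts_of_finite_biproducts C
  obtain ⟨r, hr, hr'⟩ := exists_residue k hY
  -- `y` is the `Y`-component of `u` as seen by `α`: `z ↦ α (u ≫ z)` kills radical `z`, hence is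
  -- represented through the residue pairing. The pairing of `u` and `v` is then `β (y ≫ v)`.
  have key : ∀ (Z : C) (u : X ⟶ Z), ∃ y : Y ⟶ Z, T Z → InRad u →
      ∀ z : Z ⟶ Y, α (u ≫ z) = r (y ≫ z) := by
    intro Z u
    by_cases h : T Z ∧ InRad u
    · obtain ⟨y, hy⟩ := exists_residue_comp_eq hY hr (α ∘ₗ Linear.leftComp k Y u) (Z := Z)
        fun z hz => hα _ ⟨Z, u, z, h.1, h.2, hz, rfl⟩
      exact ⟨y, fun _ _ z => hy z⟩
    · exact ⟨0, fun h₁ h₂ => (h ⟨h₁, h₂⟩).elim⟩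
  choose y hy using key
  -- `y` is determined modulo the radical, and `β` kills rad², so the value with radical `v` is
  -- independent of the choice.
  have uniq : ∀ (Z : C) (u : X ⟶ Z) (v : Z ⟶ X), T Z → InRad u → InRad v → ∀ y' : Y ⟶ Z,
      (∀ z : Z ⟶ Y, α (u ≫ z) = r (y' ≫ z)) → β (y Z u ≫ v) = β (y' ≫ v) := by
    intro Z u v hZ hu hv y' hy'
    rw [← sub_eq_zero, ← map_sub, ← Preadditive.sub_comp]
    refine hβ _ ⟨Z, _, v, hZ, ?_, hv, rfl⟩
    by_contra hrad
    obtain ⟨z, hz⟩ := exists_comp_eq_id_of_not_inRad hY hrad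
    have : r ((y Z u - y') ≫ z) = 0 := by
      rw [Preadditive.sub_comp, map_sub, ← hy Z u hZ hu, ← hy', sub_self]
    rw [hz, hr] at this
    exact one_ne_zero this
  obtain ⟨ψ, hψ⟩ := hT.exists_functional P hfin hTX hX hXp hloop (fun Z u v => β (y Z u ≫ v))
    (fun Z u u' v hZ hu hu' hv => by
      rw [uniq Z (u + u') v hZ (hu.add hu') hv (y Z u + y Z u')
        (fun z => by simp [hy Z u hZ hu, hy Z u' hZ hu'])]
      simp)
    (fun Z c u v hZ hu hv => by
      rw [uniq Z (c • u) v hZ (hu.smul c) hv (c • y Z u) (fun z => by simp [hy Z u hZ hu])]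
      simp)
    (fun Z Z' u z v hZ hZ' hu hv => by
      rw [uniq Z' (u ≫ z) v hZ' (hu.comp_right z) hv (y Z u ≫ z)
        (fun z' => by simp [hy Z u hZ hu]), Category.assoc])
    (fun Z u _ _ => by simp)
  refine ⟨ψ, fun u v => ?_, fun Z hZ hZY u v hu hv => ?_⟩
  · have hu := inRad_of_isEmpty_iso hX hY hXY u
    have hv := inRad_of_isEmpty_iso hY hX ⟨fun e => hXY.false e.symm⟩ v
    -- For `Z = Y` one may take `y = α u • 𝟙`: endomorphisms of `Y` are scalars modulo the radical,
    -- and `α` kills `u` followed by a radical map.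
    rw [hψ Y hTY u v hu hv, uniq Y u v hTY hu hv (α u • 𝟙 Y)]
    · simp
    · intro z
      obtain ⟨c, hc⟩ := exists_sub_smul_id_inRad (k := k) hY z
      have h₁ : α (u ≫ (z - c • 𝟙 Y)) = 0 := hα _ ⟨Y, u, _, hTY, hu, hc, rfl⟩
      have h₂ : r (z - c • 𝟙 Y) = 0 := (hr' _).2 hc
      simp only [Preadditive.comp_sub, Linear.comp_smul, Category.comp_id, map_sub, map_smul,
        smul_eq_mul, hr, mul_one, sub_eq_zero] at h₁ h₂
      simp [h₁, h₂, mul_comm]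
  · rw [hψ Z hZ u v hu hv, uniq Z u v hZ hu hv 0]
    · simp
    · intro z
      rw [hα _ ⟨Z, u, z, hZ, hu, hZY z, rfl⟩]
      simp

/-- The quiver of a cluster-tilting subcategory has no 2-cycles at vertices that are not
projective. -/
theorem IsClusterTilting.radSqThrough_or_radSqThrough (hT : S.IsClusterTilting T)
    {hS : S.IsFrobenius} (P : SerrePairing k hS)
    (hab : IsAbelian (ModCat C)) (hgl : hab.FiniteGlobalDimension)
    (hKS : IsKrullSchmidt C) (hfin : ∀ X Y : C, Module.Finite k (X ⟶ Y)) {X Y : C} (hTX : T X)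
    (hTY : T Y) (hX : IsLocalRing (End X)) (hY : IsLocalRing (End Y)) (hXp : ¬ S.proj X)
    (hYp : ¬ S.proj Y) (hXY : IsEmpty (X ≅ Y)) (a : X ⟶ Y) (b : Y ⟶ X) :
    RadSqThrough T a ∨ RadSqThrough T b := by
  classical
  have := hasBinaryBiproducts_of_finite_biproducts C
  by_contra! hab'
  have hYX : IsEmpty (Y ≅ X) := ⟨fun e => hXY.false e.symm⟩
  have hne : X ≠ Y := fun h => hXY.false (eqToIso h)
  obtain ⟨α, hαa, hα⟩ := Submodule.exists_le_ker_of_notMem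
    (p := radSqSubmodule k T (fun _ _ h h' => hT.biprod h h') hTX X Y) hab'.1
  obtain ⟨β, hβb, hβ⟩ := Submodule.exists_le_ker_of_notMem
    (p := radSqSubmodule k T (fun _ _ h h' => hT.biprod h h') hTX Y X) hab'.2
  obtain ⟨ψ, hψ, hψ₀⟩ := hT.exists_functional_on_paths P hfin hTX hTY hX hY hXp
    (hT.radSqThrough_of_inRad hS hab hgl hKS hfin hTX hX) hXY α (fun f hf => hα hf) β
    (fun f hf => hβ hf)
  obtain ⟨ψ', hψ', hψ₀'⟩ := hT.exists_functional_on_paths P hfin hTY hTX hY hX hYp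
    (hT.radSqThrough_of_inRad hS hab hgl hKS hfin hTY hY) hYX β (fun f hf => hβ hf) α
    (fun f hf => hα hf)
  obtain ⟨φ, hφX, hφY, hφ⟩ : ∃ φ : ∀ Z : C, (Z ⟶ Z) →+ k, φ X = ψ.toAddMonoidHom ∧
      φ Y = ψ'.toAddMonoidHom ∧ ∀ Z, Z ≠ X → Z ≠ Y → φ Z = 0 := by
    refine ⟨Function.update (β := fun Z : C => (Z ⟶ Z) →+ k)
      (Function.update (β := fun Z : C => (Z ⟶ Z) →+ k) 0 Y ψ'.toAddMonoidHom)
      X ψ.toAddMonoidHom, Function.update_self _ _ _, ?_, fun Z h₁ h₂ => ?_⟩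
    · rw [Function.update_of_ne hne.symm, Function.update_self]
    · rw [Function.update_of_ne h₁, Function.update_of_ne h₂]
      rfl
  obtain ⟨τ, hτ⟩ := hT.exists_trace (V := k) hKS (fun Z => Z = X ∨ Z = Y)
    (by rintro _ (rfl | rfl) <;> assumption) φ
    (fun Z hZ => hφ Z (fun h => hZ (Or.inl h)) (fun h => hZ (Or.inr h)))
    -- Mixed composites agree because `α u * β v` is symmetric in the two roles. For one object, `ψ`
    -- kills products of radical endomorphisms, since a radical endomorphism pair avoids the other
    -- vertex.
    (by
      rintro _ _ (rfl | rfl) (rfl | rfl) f g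
      · rw [hφX]
        exact map_comp_comm_of_isLocalRing hfin hX ψ (fun f g hf hg => hψ₀ _ hTX
          (inRad_of_isEmpty_iso hX hY hXY) f g hf hg) f g
      · rw [hφX, hφY]
        exact (hψ f g).trans ((mul_comm _ _).trans (hψ' g f).symm)
      · rw [hφX, hφY]
        exact (hψ' f g).trans ((mul_comm _ _).trans (hψ g f).symm)
      · rw [hφY]
        exact map_comp_comm_of_isLocalRing hfin hY ψ' (fun f g hf hg => hψ₀' _ hTY
          (inRad_of_isEmpty_iso hY hX hYX) f g hf hg) f g)
    (by
      rintro _ Z (rfl | rfl) hZ h₁ h₂ f g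
      · rw [hφX]
        exact hψ₀ Z hZ (h₂ _ (Or.inr rfl)) f g (h₁ _ (Or.inl rfl) f) (h₂ _ (Or.inl rfl) g)
      · rw [hφY]
        exact hψ₀' Z hZ (h₂ _ (Or.inl rfl)) f g (h₁ _ (Or.inr rfl) f) (h₂ _ (Or.inr rfl) g))
  have h := hτ X (Or.inl rfl) (a ≫ b)
  rw [hT.trace_eq_zero hS hab hgl τ hTX (a ≫ b)
    (((inRad_of_isEmpty_iso hX hY hXY a).comp_right b).isNilpotent (k := k)), hφX] at h
  exact mul_ne_zero hαa hβb ((hψ a b).symm.trans h.symm)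

end ExactStructure

/-! ### Passage from `T` to `T/P` -/

section KrullSchmidt

variable {C : Type u} [Category.{v} C] [Preadditive C] [HasFiniteBiproducts C]

/-- Each summand of a finite direct sum has a complement. -/
theorem exists_complement {n : ℕ} {Y : Fin n → C} {Z : C} (e : Z ≅ ⨁ Y) (l : Fin n) :
    ∃ (R : C) (s : R ⟶ Z) (r : Z ⟶ R), s ≫ r = 𝟙 R ∧
      (biproduct.ι Y l ≫ e.inv) ≫ r = 0 ∧ s ≫ e.hom ≫ biproduct.π Y l = 0 ∧
      (e.hom ≫ biproduct.π Y l) ≫ biproduct.ι Y l ≫ e.inv + r ≫ s = 𝟙 Z := by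
  classical
  refine ⟨⨁ Subtype.restrict (· ≠ l) Y, biproduct.fromSubtype Y (· ≠ l) ≫ e.inv,
    e.hom ≫ biproduct.toSubtype Y (· ≠ l), by simp, by simp, by simp, ?_⟩
  have h : biproduct.π Y l ≫ biproduct.ι Y l
      + biproduct.toSubtype Y (· ≠ l) ≫ biproduct.fromSubtype Y (· ≠ l) = 𝟙 _ := by
    rw [biproduct.toSubtype_fromSubtype]
    apply biproduct.hom_ext'
    intro j
    by_cases hj : j = l
    · subst hj; simp
    · simp [hj, biproduct.ι_π_ne_assoc Y hj]
  calc _ = e.hom ≫ (biproduct.π Y l ≫ biproduct.ι Y l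
      + biproduct.toSubtype Y (· ≠ l) ≫ biproduct.fromSubtype Y (· ≠ l)) ≫ e.inv := by simp
    _ = 𝟙 Z := by rw [h]; simp

end KrullSchmidt

namespace ExactStructure

section SubQuotient

variable {C : Type u} [Category.{v} C] [Preadditive C] {S : ExactStructure C}
  {T : ObjectProperty C}

/-- The quotient functor from a full subcategory `T` to `T / P`. -/
abbrev toSubQuotient (S : ExactStructure C) (T : ObjectProperty C) :
    T.FullSubcategory ⥤ SubQuotient T S.proj :=
  CategoryTheory.Quotient.functor (idealRel (S.proj.inverseImage T.ι))

theorem isZero_toSubQuotient_obj {W : T.FullSubcategory} (hW : S.proj W.obj) :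
    IsZero ((S.toSubQuotient T).obj W) := by
  rw [IsZero.iff_id_eq_zero, ← CategoryTheory.Functor.map_id,
    ← (S.toSubQuotient T).map_zero W W]
  refine (CategoryTheory.Quotient.functor_map_eq_iff _ _ _).2 ?_
  change 𝟙 W - 0 ∈ _
  rw [sub_zero]
  exact AddSubgroup.subset_closure ⟨W, hW, 𝟙 W, 𝟙 W, by simp⟩

theorem inRad_toSubQuotient_map {X Y : T.FullSubcategory} {f : X ⟶ Y} (hf : InRad f.hom) :
    InRad ((S.toSubQuotient T).map f) := by
  intro g
  obtain ⟨g, rfl⟩ := (S.toSubQuotient T).map_surjective g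
  have h : IsIso (𝟙 X - f ≫ g) := (T.isIso_hom_iff _).1 (hf g.hom)
  have := (S.toSubQuotient T).map_isIso (𝟙 X - f ≫ g)
  rwa [Functor.map_sub, CategoryTheory.Functor.map_id, Functor.map_comp] at this

theorem inRadSq_toSubQuotient_map {X Y : T.FullSubcategory} {f : X ⟶ Y}
    (hf : RadSqThrough T f.hom) : InRadSq ((S.toSubQuotient T).map f) := by
  obtain ⟨Z, g, h, hZ, hg, hh, e⟩ := hf
  let Z' : T.FullSubcategory := ⟨Z, hZ⟩
  let g' : X ⟶ Z' := ObjectProperty.homMk g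
  let h' : Z' ⟶ Y := ObjectProperty.homMk h
  have e' : f = g' ≫ h' := ObjectProperty.hom_ext _ e
  exact ⟨_, (S.toSubQuotient T).map g', (S.toSubQuotient T).map h',
    inRad_toSubQuotient_map (f := g') hg, inRad_toSubQuotient_map (f := h') hh,
    by rw [e', Functor.map_comp]⟩

/-- An arrow of `T/P` lifts to `T` by fullness. The lift is outside rad² of `T`, since the quotient
functor preserves rad²; its radicality is recorded only in the quotient. -/
theorem exists_hom_of_hasIrreducible {X Y : SubQuotient T S.proj} (h : HasIrreducible X Y)
    {W W' : T.FullSubcategory} (e : X ≅ (S.toSubQuotient T).obj W)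
    (e' : Y ≅ (S.toSubQuotient T).obj W') : ∃ f : W ⟶ W',
      InRad ((S.toSubQuotient T).map f) ∧ ¬ RadSqThrough T f.hom := by
  obtain ⟨f, hf, hf'⟩ := h
  obtain ⟨f₁, hf₁⟩ := (S.toSubQuotient T).map_surjective (e.inv ≫ f ≫ e'.hom)
  refine ⟨f₁, ?_, fun h => hf' ?_⟩
  · rw [hf₁]
    exact (hf.comp_right _).comp_left _
  · obtain ⟨Z, a, b, ha, hb, hab⟩ := inRadSq_toSubQuotient_map (S := S) h
    rw [hf₁] at hab
    refine ⟨Z, e.hom ≫ a, b ≫ e'.inv, ha.comp_left _, hb.comp_right _, ?_⟩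
    calc f = e.hom ≫ (e.inv ≫ f ≫ e'.hom) ≫ e'.inv := by simp
      _ = _ := by rw [hab]; simp

/-- Decompose a representative in `T`: some local summand stays nonzero in `T/P`, so it is not
projective, and indecomposability makes its complement zero there. -/
theorem IsClusterTilting.exists_iso_of_isIndecomposable [HasFiniteBiproducts C]
    (hT : S.IsClusterTilting T) (hKS : IsKrullSchmidt C) {X : SubQuotient T S.proj}
    (hX : IsIndecomposable X) : ∃ W : T.FullSubcategory, IsLocalRing (End W.obj) ∧
      ¬ S.proj W.obj ∧ Nonempty (X ≅ (S.toSubQuotient T).obj W) := by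
  have := hasBinaryBiproducts_of_finite_biproducts C
  let q := S.toSubQuotient T
  obtain ⟨n, Y, hY, ⟨e⟩⟩ := hKS X.as.obj
  have hTY : ∀ l, T (Y l) := fun l => hT.of_retract X.as.property
    (s := biproduct.ι Y l ≫ e.inv) (r := e.hom ≫ biproduct.π Y l) (by simp)
  let Y' : Fin n → T.FullSubcategory := fun l => ⟨Y l, hTY l⟩
  let ι : ∀ l, Y' l ⟶ X.as := fun l => ObjectProperty.homMk (biproduct.ι Y l ≫ e.inv)
  let π : ∀ l, X.as ⟶ Y' l := fun l => ObjectProperty.homMk (e.hom ≫ biproduct.π Y l)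
  have hsum : ∑ l, π l ≫ ι l = 𝟙 X.as := by
    apply T.ι.map_injective
    rw [Functor.map_sum]
    change ∑ l, (e.hom ≫ biproduct.π Y l) ≫ biproduct.ι Y l ≫ e.inv = 𝟙 _
    simp only [Category.assoc]
    rw [← Preadditive.comp_sum]
    simp only [← Category.assoc]
    rw [← Preadditive.sum_comp]
    simp [biproduct.total]
  obtain ⟨l, hl⟩ : ∃ l, ¬ IsZero (q.obj (Y' l)) := by
    by_contra! h
    apply hX.1
    rw [IsZero.iff_id_eq_zero]
    change 𝟙 (q.obj X.as) = 0
    rw [← CategoryTheory.Functor.map_id, ← hsum, Functor.map_sum]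
    refine Finset.sum_eq_zero fun l _ => ?_
    rw [Functor.map_comp, (h l).eq_of_src (q.map (ι l)) 0, comp_zero]
  obtain ⟨R, s, r, h₁, h₂, h₃, h₄⟩ := exists_complement e l
  let R' : T.FullSubcategory := ⟨R, hT.of_retract X.as.property h₁⟩
  let s' : R' ⟶ X.as := ObjectProperty.homMk s
  let r' : X.as ⟶ R' := ObjectProperty.homMk r
  have e₀ : ι l ≫ π l = 𝟙 _ := ObjectProperty.hom_ext _ (by
    change (biproduct.ι Y l ≫ e.inv) ≫ e.hom ≫ biproduct.π Y l = 𝟙 _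
    simp)
  have e₁ : s' ≫ r' = 𝟙 _ := ObjectProperty.hom_ext _ h₁
  have e₂ : ι l ≫ r' = 0 := ObjectProperty.hom_ext _ h₂
  have e₃ : s' ≫ π l = 0 := ObjectProperty.hom_ext _ h₃
  have e₄ : π l ≫ ι l + r' ≫ s' = 𝟙 _ := ObjectProperty.hom_ext _ h₄
  let b : BinaryBicone (q.obj (Y' l)) (q.obj R') :=
    { pt := q.obj X.as
      fst := q.map (π l)
      snd := q.map r'
      inl := q.map (ι l)
      inr := q.map s'
      inl_fst := by rw [← Functor.map_comp, e₀, CategoryTheory.Functor.map_id]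
      inl_snd := by rw [← Functor.map_comp, e₂, Functor.map_zero]
      inr_fst := by rw [← Functor.map_comp, e₃, Functor.map_zero]
      inr_snd := by rw [← Functor.map_comp, e₁, CategoryTheory.Functor.map_id] }
  have hb : q.map (π l) ≫ q.map (ι l) + q.map r' ≫ q.map s' = 𝟙 _ := by
    rw [← Functor.map_comp, ← Functor.map_comp, ← Functor.map_add, e₄,
      CategoryTheory.Functor.map_id]
  have hR : IsZero (q.obj R') :=
    (hX.2 _ _ b ⟨isBinaryBilimitOfTotal b hb⟩ ⟨Iso.refl _⟩).resolve_left hl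
  rw [hR.eq_of_src (q.map s') 0, comp_zero, add_zero] at hb
  exact ⟨Y' l, hY l, fun hp => hl (isZero_toSubQuotient_obj hp),
    ⟨⟨q.map (π l), q.map (ι l), hb, b.inl_fst⟩⟩⟩

theorem IsClusterTilting.exists_iso_of_quiverVertex [HasFiniteBiproducts C]
    (hT : S.IsClusterTilting T) (hKS : IsKrullSchmidt C)
    (x : QuiverVertex (SubQuotient T S.proj)) :
    ∃ W : T.FullSubcategory, IsLocalRing (End W.obj) ∧ ¬ S.proj W.obj ∧
      IsIndecomposable ((S.toSubQuotient T).obj W) ∧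
      ∀ X, _root_.Quotient.mk (isIsomorphicSetoid _) X = x.1 →
        Nonempty (X ≅ (S.toSubQuotient T).obj W) := by
  obtain ⟨x, X, hX, rfl⟩ := x
  obtain ⟨W, h₁, h₂, ⟨e⟩⟩ := hT.exists_iso_of_isIndecomposable hKS hX
  refine ⟨W, h₁, h₂, ⟨fun h => hX.1 (h.of_iso e), fun Y Z b hb ⟨e'⟩ => hX.2 Y Z b hb ⟨e ≪≫ e'⟩⟩,
    fun X' hX' => ?_⟩
  obtain ⟨e'⟩ := _root_.Quotient.exact hX'
  exact ⟨e' ≪≫ e⟩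

end SubQuotient

variable {k : Type w} [Field k] [IsAlgClosed k] {C : Type u} [Category.{v} C] [Preadditive C]
  [Linear k C] [HasFiniteBiproducts C] {S : ExactStructure C} {T : ObjectProperty C}

theorem IsClusterTilting.not_hasIrreducible_self (hT : S.IsClusterTilting T) (hS : S.IsFrobenius)
    (hab : IsAbelian (ModCat C)) (hgl : hab.FiniteGlobalDimension)
    (hKS : IsKrullSchmidt C) (hfin : ∀ X Y : C, Module.Finite k (X ⟶ Y)) {W : T.FullSubcategory}
    (hW : IsLocalRing (End W.obj)) (hW' : IsIndecomposable ((S.toSubQuotient T).obj W))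
    {X Y : SubQuotient T S.proj} (e : X ≅ (S.toSubQuotient T).obj W)
    (e' : Y ≅ (S.toSubQuotient T).obj W) : ¬ HasIrreducible X Y := by
  intro h
  obtain ⟨f, hf, hf'⟩ := exists_hom_of_hasIrreducible h e e'
  refine hf' (hT.radSqThrough_of_inRad hS hab hgl hKS hfin W.property hW f.hom ?_)
  -- On a local object radical means not invertible, and an invertible `f` would stay invertible in
  -- `T/P`, where it is radical. So radicality descends from `T/P` to `T`.
  rw [inRad_iff_not_isIso hW]
  intro hiso
  have : IsIso f := (T.isIso_hom_iff f).1 hiso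
  exact hf.not_isIso (fun h0 => hW'.1 ((IsZero.iff_id_eq_zero _).2 h0))
    ((S.toSubQuotient T).map_isIso f)

end ExactStructure

end FrobeniusCT

/-! ### Conclusion -/

theorem theorem6p22 {k : Type w} [Field k] [IsAlgClosed k]
    {E : Type u} [Category.{v} E] [Preadditive E] [Linear k E] [HasFiniteBiproducts E]
    (hKS : FrobeniusCT.IsKrullSchmidt E)
    (hfin : ∀ X Y : E, Module.Finite k (X ⟶ Y))
    (hab : FrobeniusCT.IsAbelian (FrobeniusCT.ModCat E))
    (hgl : hab.FiniteGlobalDimension)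
    (S : FrobeniusCT.ExactStructure E) (hS : S.IsFrobenius)
    (hCY : FrobeniusCT.ExactStructure.IsTwoCalabiYau k hS)
    (T : ObjectProperty E) (hT : S.IsClusterTilting T) :
    FrobeniusCT.NoLoops (FrobeniusCT.QuiverVertex (FrobeniusCT.SubQuotient T S.proj)) ∧
    FrobeniusCT.NoTwoCycles (FrobeniusCT.QuiverVertex (FrobeniusCT.SubQuotient T S.proj)) := by
  obtain ⟨P⟩ := hCY.nonempty_serrePairing hfin
  refine ⟨fun x => ⟨?_⟩, fun x y => ⟨?_⟩⟩
  · rintro ⟨X, Y, hX, hY, h⟩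
    obtain ⟨W, hW, -, hW', hx⟩ := hT.exists_iso_of_quiverVertex hKS x
    exact hT.not_hasIrreducible_self hS hab hgl hKS hfin hW hW' (hx X hX).some (hx Y hY).some h
  · rintro ⟨⟨X, Y, hX, hY, h⟩, ⟨Y', X', hY', hX', h'⟩⟩
    obtain ⟨W, hW, hWp, hWi, hx⟩ := hT.exists_iso_of_quiverVertex hKS x
    obtain ⟨V, hV, hVp, hVi, hy⟩ := hT.exists_iso_of_quiverVertex hKS y
    by_cases hWV : Nonempty (W.obj ≅ V.obj)
    -- If the two representatives are isomorphic in `T`, the 2-cycle already contains a loop.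
    · exact hT.not_hasIrreducible_self hS hab hgl hKS hfin hW hWi (hx X hX).some
        ((hy Y hY).some ≪≫ (S.toSubQuotient T).mapIso (T.isoMk hWV.some).symm) h
    · rw [not_nonempty_iff] at hWV
      obtain ⟨f, -, hf⟩ := FrobeniusCT.ExactStructure.exists_hom_of_hasIrreducible h
        (hx X hX).some (hy Y hY).some
      obtain ⟨g, -, hg⟩ := FrobeniusCT.ExactStructure.exists_hom_of_hasIrreducible h'
        (hy Y' hY').some (hx X' hX').some
      exact (hT.radSqThrough_or_radSqThrough P hab hgl hKS hfin W.property V.property hW hV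
        hWp hVp hWV f.hom g.hom).elim hf hg
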